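/- **Theorem ($\ell_p$ subspace approximation via exponential scaling).** There is a universal constant $C>0$ such that the following holds. Let $n,d,k$ be integers with $k\ge 1$, let $p\in[1,\infty)$ be real, and let $A\in\mathbb{R}^{n\times d}$ have rows $a_1,\dots,a_n$. *Notation.* For a matrix $B$ with rows $b_i\in\mathbb{R}^d$ and a subspace $V\subseteq\mathbb{R}^d$ with orthogonal projection $\mathbb{P}_V$, put $d(b,V)=\|(I-\mathbb{P}_V)b\|_2$, $\|B(I-\mathbb{P}_V)\|_{p,2}=\big(\sum_i d(b_i,V)^p\big)^{1/p}$ and $\|B(I-\mathbb{P}_V)\|_{\infty,2}=\max_i d(b_i,V)$ (which is $0$ if $B$ has no rows). $B_S$ is the submatrix of the rows with index in $S$, $B_{1:i}$ that of the first $i$ rows, $M^+$ is the Moore–Penrose pseudoinverse, and $[B]_k$ is a best approximation of $B$ in Frobenius norm by a matrix of rank at most $k$. *Algorithm 1* on the rows $b_1,\dots,b_n$ of $B$ with parameter $k$: start with $S=\emptyset$, $\lambda=0$. For $t=1,\dots,n$: if $\lambda=0$ and $b_t\notin\mathrm{rowspace}(B_S)$, add $t$ to $S$; otherwise, if $b_t^{\mathsf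 T}(B_S^{\mathsf T}B_S+\lambda I)^{+}b_t\ge 1/(1+1/k)$, add $t$ to $S$; then set $\lambda=\|B_S-[B_S]_k\|_F^2/k$. Return $S$. *Condition number.* Let $i^*$ be the largest $i\le n$ with $\mathrm{rank}(A_{1:i})=k$ ($i^*=0$ if there is none). The online rank-$k$ condition number of $A$ is $$\kappa=\frac{\|A\|_2}{\min_{i\le i^*+1}\sigma_{\min}(A_{1:i})},$$ where $\sigma_{\min}$ is the smallest nonzero singular value, and prefixes $A_{1:i}=0$ are left out of the minimum. If no prefix is left, $\kappa$ is read as $0$, and $\log 0$ is read as $0$. *Claim.* Let $\mathbf{e}_1,\dots,\mathbf{e}_n$ be independent standard exponential random variables, $\mathbf{D}=\mathrm{diag}\big(\lceil \mathbf{e}_1^{-1/p}\rceil,\dots,\lceil \mathbf{e}_n^{-1/p}\rceil\big)$, and let $S$ be the output of Algorithm 1 on $\mathbf{D}A$ with parameter $k$. Then, with probability at least $9/10$, the following holds simultaneously for all real $\beta$ and all $k$-dimensional subspaces $\hat V\subseteq\mathbb{R}^d$: if $\hat V$ is a $\beta$-approximate solution of $\min_{k\text{-dim }V}\|(\mathbf{D}A)_S(I-\mathbb{P}_V)\|_{\infty,2}$,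 that is, $$\|(\mathbf{D}A)_S(I-\mathbb{P}_{\hat V})\|_{\infty,2}\le\beta\,\|(\mathbf{D}A)_S(I-\mathbb{P}_{V})\|_{\infty,2}\quad\text{for all $k$-dimensional } V,$$ then $$\|A(I-\mathbb{P}_{\hat V})\|_{p,2}\le \beta\cdot C\,k^{1/2+2/p}\,\log^{1+3/p}(n\kappa)\cdot\|A(I-\mathbb{P}_V)\|_{p,2}\quad\text{for all $k$-dimensional } V.$$ -/

import Mathlib

open MeasureTheory ProbabilityTheory

namespace SubspaceApprox

noncomputable section

/-! ### Matrices and their rows -/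

/-- The `i`-th row of `A`, as a point of Euclidean space. -/
def row {ι : Type*} {d : ℕ} (A : Matrix ι (Fin d) ℝ) (i : ι) : EuclideanSpace ℝ (Fin d) :=
  WithLp.toLp 2 (A i)

/-- The submatrix `A_S` formed by the rows whose index lies in `S`. -/
def restrictRows {n d : ℕ} (A : Matrix (Fin n) (Fin d) ℝ) (S : Finset (Fin n)) :
    Matrix S (Fin d) ℝ :=
  A.submatrix (fun i : S => (i : Fin n)) id

/-- The submatrix `A_{1:i}` formed by the first `i` rows of `A` (all of `A` when `n ≤ i`). -/
def firstRows {n d : ℕ} (A : Matrix (Fin n) (Fin d) ℝ) (i : ℕ) :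
    Matrix {j : Fin n // (j : ℕ) < i} (Fin d) ℝ :=
  A.submatrix (fun j => (j : Fin n)) id

/-- The row space of `A`. -/
def rowspace {ι : Type*} {d : ℕ} (A : Matrix ι (Fin d) ℝ) :
    Submodule ℝ (EuclideanSpace ℝ (Fin d)) :=
  Submodule.span ℝ (Set.range (row A))

/-- The squared Frobenius norm. -/
def frobSq {ι : Type*} [Fintype ι] {d : ℕ} (A : Matrix ι (Fin d) ℝ) : ℝ :=
  ∑ i, ∑ j, A i j ^ 2

/-- `‖A - [A]_k‖_F²`, where `[A]_k` is a best approximation of `A` in Frobenius norm among the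
matrices of rank at most `k`. -/
def rankTailSq {ι : Type*} [Fintype ι] {d : ℕ} (k : ℕ) (A : Matrix ι (Fin d) ℝ) : ℝ :=
  ⨅ B : {B : Matrix ι (Fin d) ℝ // B.rank ≤ k}, frobSq (A - B.1)

/-! ### The Moore-Penrose pseudoinverse -/

/-- The four Penrose conditions: `X` is the Moore-Penrose pseudoinverse of the real matrix `M`. -/
structure IsMoorePenrose {m n : Type*} [Fintype m] [Fintype n]
    (M : Matrix m n ℝ) (X : Matrix n m ℝ) : Prop where
  mul_mul_self : M * X * M = M
  mul_mul_inv : X * M * X = X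
  symm_left : (M * X).transpose = M * X
  symm_right : (X * M).transpose = X * M

theorem IsMoorePenrose.unique {m n : Type*} [Fintype m] [Fintype n]
    {M : Matrix m n ℝ} {X Y : Matrix n m ℝ}
    (hX : IsMoorePenrose M X) (hY : IsMoorePenrose M Y) : X = Y := by
  have h1 : M * X = M * Y := by
    calc M * X = (M * X).transpose := hX.symm_left.symm
      _ = ((M * Y) * (M * X)).transpose := by
          rw [← Matrix.mul_assoc (M * Y) M X, hY.mul_mul_self]
      _ = (M * X) * (M * Y) := by rw [Matrix.transpose_mul, hX.symm_left, hY.symm_left]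
      _ = M * Y := by rw [← Matrix.mul_assoc, hX.mul_mul_self]
  have h2 : X * M = Y * M := by
    calc X * M = (X * M).transpose := hX.symm_right.symm
      _ = ((X * M) * (Y * M)).transpose := by
          rw [Matrix.mul_assoc X M (Y * M), ← Matrix.mul_assoc M Y M, hY.mul_mul_self]
      _ = (Y * M) * (X * M) := by rw [Matrix.transpose_mul, hX.symm_right, hY.symm_right]
      _ = Y * M := by rw [Matrix.mul_assoc, ← Matrix.mul_assoc M X M, hX.mul_mul_self]
  calc X = X * M * X := hX.mul_mul_inv.symm
    _ = Y * M * Y := by rw [h2, Matrix.mul_assoc, h1, Matrix.mul_assoc]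
    _ = Y := hY.mul_mul_inv

theorem exists_isMoorePenrose {d : ℕ} {M : Matrix (Fin d) (Fin d) ℝ} (hM : M.IsHermitian) :
    ∃ X, IsMoorePenrose M X := by
  classical
  set U : Matrix (Fin d) (Fin d) ℝ := hM.eigenvectorUnitary.val with hU
  set L : Matrix (Fin d) (Fin d) ℝ := Matrix.diagonal hM.eigenvalues with hL
  set K : Matrix (Fin d) (Fin d) ℝ := Matrix.diagonal (fun i => (hM.eigenvalues i)⁻¹) with hK
  have hUU : U.transpose * U = 1 := by
    have := Unitary.coe_star_mul_self hM.eigenvectorUnitary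
    simpa [Matrix.star_eq_conjTranspose] using this
  have hspec : M = U * L * U.transpose := by
    have := hM.spectral_theorem
    rw [Unitary.conjStarAlgAut_apply] at this
    simpa [Matrix.star_eq_conjTranspose, Function.comp_def] using this
  have hmul : ∀ P Q : Matrix (Fin d) (Fin d) ℝ,
      (U * P * U.transpose) * (U * Q * U.transpose) = U * (P * Q) * U.transpose := by
    intro P Q
    calc (U * P * U.transpose) * (U * Q * U.transpose)
        = U * P * (U.transpose * U) * Q * U.transpose := by simp only [Matrix.mul_assoc]
      _ = U * (P * Q) * U.transpose := by rw [hUU, Matrix.mul_one, Matrix.mul_assoc U P Q]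
  have hLKL : L * K * L = L := by
    simp only [hL, hK, Matrix.diagonal_mul_diagonal]
    congr 1; ext i; exact mul_inv_mul_cancel (hM.eigenvalues i)
  have hKLK : K * L * K = K := by
    simp only [hL, hK, Matrix.diagonal_mul_diagonal]
    congr 1; ext i
    by_cases h : hM.eigenvalues i = 0
    · simp [h]
    · field_simp
  refine ⟨U * K * U.transpose, ?_, ?_, ?_, ?_⟩
  · rw [hspec, hmul, hmul, hLKL]
  · rw [hspec, hmul, hmul, hKLK]
  · rw [hspec, hmul]
    simp [hL, hK, Matrix.transpose_mul, Matrix.mul_assoc]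
  · rw [hspec, hmul]
    simp [hL, hK, Matrix.transpose_mul, Matrix.mul_assoc]

open Classical in
/-- The Moore-Penrose pseudoinverse `M⁺` of a square real matrix. It is unique
(`IsMoorePenrose.unique`) and exists for the symmetric matrices to which it is applied below
(`exists_isMoorePenrose`). -/
def pinv {d : ℕ} (M : Matrix (Fin d) (Fin d) ℝ) : Matrix (Fin d) (Fin d) ℝ :=
  if h : ∃ X, IsMoorePenrose M X then h.choose else 0

theorem isMoorePenrose_pinv {d : ℕ} {M : Matrix (Fin d) (Fin d) ℝ} (hM : M.IsHermitian) :
    IsMoorePenrose M (pinv M) := by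
  have h := exists_isMoorePenrose hM
  unfold pinv
  rw [dif_pos h]
  exact h.choose_spec

/-! ### The coreset algorithm -/

/-- `aᵀ (BᵀB + lam • I)⁺ a`. -/
def ridgeScore {ι : Type*} [Fintype ι] {d : ℕ} (B : Matrix ι (Fin d) ℝ) (lam : ℝ)
    (a : Fin d → ℝ) : ℝ :=
  a ⬝ᵥ (pinv (B.transpose * B + lam • (1 : Matrix (Fin d) (Fin d) ℝ))).mulVec a

open Classical in
/-- The selection made when row `t` is processed in the state `(S, lam)`. -/
def selectRow {n d : ℕ} (k : ℕ) (A : Matrix (Fin n) (Fin d) ℝ)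
    (S : Finset (Fin n)) (lam : ℝ) (t : Fin n) : Finset (Fin n) :=
  if lam = 0 ∧ row A t ∉ rowspace (restrictRows A S) then insert t S
  else if 1 / (1 + 1 / (k : ℝ)) ≤ ridgeScore (restrictRows A S) lam (A t) then insert t S
  else S

/-- One iteration of the loop: update `S`, then set `lam` to `‖A_S - [A_S]_k‖_F² / k`. -/
def coresetStep {n d : ℕ} (k : ℕ) (A : Matrix (Fin n) (Fin d) ℝ)
    (st : Finset (Fin n) × ℝ) (t : Fin n) : Finset (Fin n) × ℝ :=
  (selectRow k A st.1 st.2 t,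
    rankTailSq k (restrictRows A (selectRow k A st.1 st.2 t)) / (k : ℝ))

/-- The set of rows selected by the algorithm on the stream `a_1, …, a_n`, started from `S = ∅`
and `lam = 0`. -/
def coreset {n d : ℕ} (k : ℕ) (A : Matrix (Fin n) (Fin d) ℝ) : Finset (Fin n) :=
  ((List.finRange n).foldl (coresetStep k A) (∅, 0)).1

/-! ### The online rank-`k` condition number -/

/-- `x ↦ B x` between Euclidean spaces. -/
def euclideanMap {ι : Type*} [Fintype ι] {d : ℕ} (B : Matrix ι (Fin d) ℝ) :
    EuclideanSpace ℝ (Fin d) →ₗ[ℝ] EuclideanSpace ℝ ι :=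
  Matrix.toLpLin 2 2 B

/-- The operator norm `‖B‖₂`. -/
def opNorm {ι : Type*} [Fintype ι] {d : ℕ} (B : Matrix ι (Fin d) ℝ) : ℝ :=
  ‖LinearMap.toContinuousLinearMap (euclideanMap B)‖

/-- The smallest nonzero singular value of a nonzero matrix `B`. The singular values are listed in
decreasing order from index `0`, and exactly the first `B.rank` of them are nonzero. -/
def sigmaMin {ι : Type*} [Fintype ι] {d : ℕ} (B : Matrix ι (Fin d) ℝ) : ℝ :=
  (euclideanMap B).singularValues (B.rank - 1)

open Classical in
/-- The largest `i ≤ n` such that the first `i` rows of `A` have rank exactly `k`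
(`0` if there is none). -/
def lastRankIndex {n d : ℕ} (k : ℕ) (A : Matrix (Fin n) (Fin d) ℝ) : ℕ :=
  Nat.findGreatest (fun i => (firstRows A i).rank = k) n

/-- The online rank-`k` condition number `‖A‖₂ / min_{i ≤ i⋆ + 1} σ_min(A_{1:i})`, where `i⋆` is the
largest index with `rank A_{1:i⋆} = k`. Prefixes `A_{1:i}` that vanish have no nonzero singular
value and do not enter the minimum. -/
def onlineCond {n d : ℕ} (k : ℕ) (A : Matrix (Fin n) (Fin d) ℝ) : ℝ :=
  opNorm A / sInf {s : ℝ | ∃ i : ℕ, i ≤ lastRankIndex k A + 1 ∧ firstRows A i ≠ 0 ∧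
    s = sigmaMin (firstRows A i)}

/-! ### Subspace approximation -/

/-- `d(x, V) = ‖(I - P_V) x‖₂`. -/
def distTo {d : ℕ} (V : Submodule ℝ (EuclideanSpace ℝ (Fin d)))
    (x : EuclideanSpace ℝ (Fin d)) : ℝ :=
  ‖x - V.starProjection x‖

/-- `‖A (I - P_V)‖_{p,2} = (∑_i d(a_i, V)^p)^{1/p}`. -/
def lpCost {ι : Type*} [Fintype ι] {d : ℕ} (p : ℝ) (A : Matrix ι (Fin d) ℝ)
    (V : Submodule ℝ (EuclideanSpace ℝ (Fin d))) : ℝ :=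
  (∑ i, distTo V (row A i) ^ p) ^ (1 / p)

/-- `‖A (I - P_V)‖_{∞,2} = max_i d(a_i, V)` (which is `0` if `A` has no rows). -/
def linfCost {ι : Type*} {d : ℕ} (A : Matrix ι (Fin d) ℝ)
    (V : Submodule ℝ (EuclideanSpace ℝ (Fin d))) : ℝ :=
  ⨆ i, distTo V (row A i)

/-- `V` is a `β`-approximate solution of the problem of minimizing `cost` over all `k`-dimensional
subspaces. -/
def IsApproxSolution {d : ℕ} (k : ℕ) (cost : Submodule ℝ (EuclideanSpace ℝ (Fin d)) → ℝ)
    (β : ℝ) (V : Submodule ℝ (EuclideanSpace ℝ (Fin d))) : Prop :=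
  Module.finrank ℝ V = k ∧
    ∀ W : Submodule ℝ (EuclideanSpace ℝ (Fin d)), Module.finrank ℝ W = k → cost V ≤ β * cost W

/-- The diagonal matrix with entries `⌈x_i^{-1/p}⌉`. -/
def scaling {n : ℕ} (p : ℝ) (x : Fin n → ℝ) : Matrix (Fin n) (Fin n) ℝ :=
  Matrix.diagonal fun i => ((⌈x i ^ (-1 / p)⌉ : ℤ) : ℝ)

end

end SubspaceApprox

namespace SubspaceApprox

/-! ### Distances to subspaces -/

section Distance

variable {d : ℕ} {V : Submodule ℝ (EuclideanSpace ℝ (Fin d))} {x y : EuclideanSpace ℝ (Fin d)}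

/-! Write `b_i = D_i a_i` for the scaled rows, `S` for the selected set, `M` for the max-cost on `S`
of the given solution `V`, and `L = log (n κ)`.

For fixed weights `w_i ≥ 0` with positive sum, `min_i e_i / w_i` is exponential of rate `∑ w_i`.
With `w_i = d(a_i, V)^p` this makes `max_i D_i d(a_i, V)` a proxy for the `p`-cost of `V`. That the
proxy is not too large is needed for a single near-optimal `V₀` only (`ceil_rpow_mul_distTo_le`).
That it is not too small is needed for the output `V`, which depends on the randomness, so a union
bound over a net is required.

The coreset enters in two ways. First, it is small: `|S| ≤ 6300 k L²` (`card_coreset_le_log`). While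
`λ` stays in a window `[μ, 2μ)`, each selected row multiplies `det (μ I + ∑ b_i b_iᵀ)` by at least
`5/4`; since the rank-`k` error is then `O(k μ)`, this determinant is at most `μ^d (1 + 2F/μ)^k
e^{O(k)}`, with `F` a bound for the squared Frobenius norm. So a window contains `O(k L)` selected
rows, and there are `O(L)` windows, because a nonzero `λ` is bounded below through the smallest
singular values of the prefixes (`lamAt_eq_zero_or_le`). Second, it controls the other rows: a row
that is not selected has ridge score below `1`, and testing this with the component of the row
orthogonal to a subspace gives `D_t d(a_t, ·) ≤ Y := √(2|S|) M` for all `t`, both for `V` and for `W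
= span S` (`distTo_sq_le_linfCost`, `distTo_span_coreset_sq_le`).

The second bound makes the union bound independent of `d`. Up to `d(a_t, W)`, the distance `d(a_t,
V)` is that of the projection of `a_t` to `W`, and on `W` the distance to `V` depends only on the
projections to `W` of an orthonormal basis of `V`. A net for these `k` vectors in the unit ball of
`W`, together with the choice of at most `s ≈ k L²` rows spanning `W`, has logarithm `R = O(k s L) =
O(k² L³)`. For every net point some index `i` satisfies `e_i ∑ w_j ≤ R w_i`, whence the `p`-cost of
`V` is at most `R^{1/p} · 5Y` (`lpCost_le_of_netWeight`). With `Y = O(√k L) M` and `M ≤ β · 101 ·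
cost(V₀)`, this yields the factor `k^{1/2+2/p} L^{1+3/p}`.

If the rank of `A` is at most `k`, then `λ` stays `0`, `S` spans the row space, and every cost
concerned vanishes (`isApproxSolution_of_finrank_le`). -/

theorem distTo_nonneg : 0 ≤ distTo V x := norm_nonneg _

theorem distTo_eq_zero_iff : distTo V x = 0 ↔ x ∈ V := by
  rw [distTo, norm_eq_zero, sub_eq_zero, eq_comm, Submodule.starProjection_eq_self_iff]

theorem distTo_smul (c : ℝ) : distTo V (c • x) = |c| * distTo V x := by
  rw [distTo, distTo, map_smul, ← smul_sub, norm_smul, Real.norm_eq_abs]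

theorem distTo_le_norm_sub (hy : y ∈ V) : distTo V x ≤ ‖x - y‖ := by
  rw [distTo, Submodule.starProjection_minimal]
  exact ciInf_le ⟨0, by rintro _ ⟨z, rfl⟩; exact norm_nonneg _⟩ (⟨y, hy⟩ : V)

theorem distTo_le_norm : distTo V x ≤ ‖x‖ := by
  simpa using distTo_le_norm_sub (x := x) V.zero_mem

theorem distTo_add_le : distTo V (x + y) ≤ distTo V x + distTo V y := by
  rw [distTo, distTo, distTo, map_add, add_sub_add_comm]
  exact norm_add_le _ _

theorem sub_starProjection_mem : x - V.starProjection x ∈ Vᗮ :=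
  V.sub_starProjection_mem_orthogonal x

theorem inner_self_sub_starProjection :
    inner ℝ x (x - V.starProjection x) = distTo V x ^ 2 := by
  have h : inner ℝ (V.starProjection x) (x - V.starProjection x) = 0 :=
    V.inner_right_of_mem_orthogonal (V.starProjection_apply_mem x) sub_starProjection_mem
  rw [distTo, ← real_inner_self_eq_norm_sq]
  conv_rhs => rw [inner_sub_left, h, sub_zero]

theorem inner_sq_le_distTo_sq (hy : y ∈ Vᗮ) :
    inner ℝ x y ^ 2 ≤ distTo V x ^ 2 * ‖y‖ ^ 2 := by
  have h : inner ℝ x y = inner ℝ (x - V.starProjection x) y := by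
    rw [inner_sub_left, V.inner_right_of_mem_orthogonal (V.starProjection_apply_mem x) hy, sub_zero]
  rw [h, ← mul_pow, ← sq_abs]
  exact pow_le_pow_left₀ (abs_nonneg _) (abs_real_inner_le_norm _ _) 2

theorem distTo_sq : distTo V x ^ 2 = ‖x‖ ^ 2 - ‖V.starProjection x‖ ^ 2 := by
  have h : inner ℝ (V.starProjection x) (x - V.starProjection x) = 0 :=
    V.inner_right_of_mem_orthogonal (V.starProjection_apply_mem x) sub_starProjection_mem
  have := norm_add_sq_eq_norm_sq_add_norm_sq_of_inner_eq_zero _ _ h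
  rw [add_sub_cancel] at this
  rw [distTo]
  nlinarith

end Distance

/-! ### Subspaces spanned by rows -/

section Rows

variable {d : ℕ}

theorem rowspace_restrictRows {n : ℕ} (B : Matrix (Fin n) (Fin d) ℝ) (U : Finset (Fin n)) :
    rowspace (restrictRows B U) = Submodule.span ℝ (row B '' (U : Set (Fin n))) := by
  rw [rowspace]
  congr 1
  ext x
  constructor
  · rintro ⟨i, rfl⟩
    exact ⟨i, i.2, rfl⟩
  · rintro ⟨i, hi, rfl⟩
    exact ⟨⟨i, hi⟩, rfl⟩

theorem finrank_rowspace {ι : Type*} [Fintype ι] (B : Matrix ι (Fin d) ℝ) :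
    Module.finrank ℝ (rowspace B) = B.rank := by
  rw [Matrix.rank_eq_finrank_span_row, rowspace]
  have h : Submodule.span ℝ (Set.range (row B)) =
      (Submodule.span ℝ (Set.range B.row)).map
        (WithLp.linearEquiv 2 ℝ (Fin d → ℝ)).symm.toLinearMap := by
    rw [Submodule.map_span, ← Set.range_comp]
    rfl
  rw [h]
  exact LinearEquiv.finrank_map_eq _ _

/-- The quadratic form `x ↦ ∑_{i ∈ U} ⟪b_i, x⟫²`. -/
noncomputable def rowForm {ι : Type*} (b : ι → EuclideanSpace ℝ (Fin d)) (U : Finset ι)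
    (x : EuclideanSpace ℝ (Fin d)) : ℝ :=
  ∑ i ∈ U, inner ℝ (b i) x ^ 2

variable {ι : Type*} {b : ι → EuclideanSpace ℝ (Fin d)} {U T : Finset ι}
  {x : EuclideanSpace ℝ (Fin d)}

theorem rowForm_nonneg : 0 ≤ rowForm b U x := Finset.sum_nonneg fun _ _ => sq_nonneg _

theorem rowForm_mono (h : U ⊆ T) : rowForm b U x ≤ rowForm b T x :=
  Finset.sum_le_sum_of_subset_of_nonneg h fun _ _ _ => sq_nonneg _

theorem rowForm_le_sum_distTo {V : Submodule ℝ (EuclideanSpace ℝ (Fin d))} (hx : x ∈ Vᗮ) :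
    rowForm b U x ≤ (∑ i ∈ U, distTo V (b i) ^ 2) * ‖x‖ ^ 2 := by
  rw [rowForm, Finset.sum_mul]
  exact Finset.sum_le_sum fun i _ => inner_sq_le_distTo_sq hx

theorem rowForm_starProjection_span {W : Submodule ℝ (EuclideanSpace ℝ (Fin d))}
    (hW : ∀ i ∈ U, b i ∈ W) : rowForm b U (W.starProjection x) = rowForm b U x := by
  refine Finset.sum_congr rfl fun i hi => ?_
  rw [← Submodule.inner_starProjection_left_eq_right,
    Submodule.starProjection_eq_self_iff.mpr (hW i hi)]

theorem mem_orthogonal_span_of_rowForm_eq_zero (h : rowForm b U x = 0) :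
    x ∈ (Submodule.span ℝ (b '' (U : Set ι)))ᗮ := by
  rw [Submodule.mem_orthogonal]
  intro u hu
  induction hu using Submodule.span_induction with
  | mem u hu =>
    obtain ⟨i, hi, rfl⟩ := hu
    exact pow_eq_zero_iff two_ne_zero |>.mp
      ((Finset.sum_eq_zero_iff_of_nonneg fun i _ => sq_nonneg _).mp h i hi)
  | zero => simp
  | add u v _ _ hu hv => rw [inner_add_left, hu, hv, add_zero]
  | smul c u _ hu => rw [inner_smul_left, hu, mul_zero]

/-- The form vanishes only on the orthogonal complement of the span, so it is definite on the span,
and a definite form in finite dimension is bounded below. This is what makes a vanishing rank-`k`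
error force rank at most `k`. -/
theorem exists_antilipschitz_rowForm (b : ι → EuclideanSpace ℝ (Fin d)) (U : Finset ι) :
    ∃ c : ℝ, 0 < c ∧ ∀ x ∈ Submodule.span ℝ (b '' (U : Set ι)), c * ‖x‖ ^ 2 ≤ rowForm b U x := by
  classical
  let W := Submodule.span ℝ (b '' (U : Set ι))
  let T : EuclideanSpace ℝ (Fin d) →ₗ[ℝ] EuclideanSpace ℝ U :=
    (WithLp.linearEquiv 2 ℝ (U → ℝ)).symm.toLinearMap ∘ₗ
      LinearMap.pi fun i : U => (innerSL ℝ (b i)).toLinearMap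
  have hT : ∀ x, ‖T x‖ ^ 2 = rowForm b U x := by
    intro x
    rw [EuclideanSpace.norm_sq_eq, rowForm, ← Finset.sum_coe_sort U]
    simp [T]
  have hker : LinearMap.ker (T.domRestrict W) = ⊥ := by
    rw [LinearMap.ker_eq_bot']
    rintro ⟨x, hx⟩ h0
    have h0' : T x = 0 := h0
    have h1 : rowForm b U x = 0 := by rw [← hT, h0', norm_zero]; norm_num
    have h3 : x ∈ Wᗮ := mem_orthogonal_span_of_rowForm_eq_zero h1
    have h4 : inner ℝ x x = 0 := Submodule.inner_right_of_mem_orthogonal hx h3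
    simpa using h4
  obtain ⟨K, hK, hlip⟩ := (T.domRestrict W).exists_antilipschitzWith hker
  refine ⟨((K : ℝ) ^ 2)⁻¹, by positivity, fun x hx => ?_⟩
  have h := hlip.le_mul_dist ⟨x, hx⟩ 0
  rw [map_zero, dist_zero_right, dist_zero_right] at h
  have h' : ‖x‖ ≤ K * ‖T x‖ := h
  rw [← hT, inv_mul_le_iff₀ (by positivity), ← mul_pow]
  exact pow_le_pow_left₀ (norm_nonneg _) h' 2

end Rows

/-! ### The error of the best approximation of rank at most `k` -/

section Tail

variable {n d k : ℕ} (B : Matrix (Fin n) (Fin d) ℝ) (U : Finset (Fin n))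

theorem frobSq_eq_sum_norm_row {ι : Type*} [Fintype ι] (C : Matrix ι (Fin d) ℝ) :
    frobSq C = ∑ i, ‖row C i‖ ^ 2 := by
  simp [frobSq, row, EuclideanSpace.norm_sq_eq]

theorem frobSq_nonneg {ι : Type*} [Fintype ι] (C : Matrix ι (Fin d) ℝ) : 0 ≤ frobSq C :=
  Finset.sum_nonneg fun _ _ => Finset.sum_nonneg fun _ _ => sq_nonneg _

theorem rankTailSq_nonneg {ι : Type*} [Fintype ι] (C : Matrix ι (Fin d) ℝ) :
    0 ≤ rankTailSq k C :=
  Real.iInf_nonneg fun _ => frobSq_nonneg _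

theorem rankTailSq_le_sum_distTo {V : Submodule ℝ (EuclideanSpace ℝ (Fin d))}
    (hV : Module.finrank ℝ V ≤ k) :
    rankTailSq k (restrictRows B U) ≤ ∑ i ∈ U, distTo V (row B i) ^ 2 := by
  let C : Matrix U (Fin d) ℝ := fun i => (V.starProjection (row B i)).ofLp
  have hC : C.rank ≤ k := by
    rw [← finrank_rowspace]
    refine (Submodule.finrank_mono ?_).trans hV
    rw [rowspace, Submodule.span_le]
    rintro _ ⟨i, rfl⟩
    exact V.starProjection_apply_mem _
  refine (ciInf_le ⟨0, ?_⟩ (⟨C, hC⟩ : {C : Matrix U (Fin d) ℝ // C.rank ≤ k})).trans_eq ?_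
  · rintro _ ⟨C, rfl⟩
    exact frobSq_nonneg _
  · rw [frobSq_eq_sum_norm_row, ← Finset.sum_coe_sort U]
    rfl

/-- The row space of a nearly optimal approximation serves as `V`. The slack `ε` makes it
unnecessary to know that the infimum is attained. -/
theorem exists_sum_distTo_lt {ε : ℝ} (hε : 0 < ε) :
    ∃ V : Submodule ℝ (EuclideanSpace ℝ (Fin d)), Module.finrank ℝ V ≤ k ∧
      ∑ i ∈ U, distTo V (row B i) ^ 2 < rankTailSq k (restrictRows B U) + ε := by
  have : Nonempty {C : Matrix U (Fin d) ℝ // C.rank ≤ k} := ⟨⟨0, by simp⟩⟩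
  obtain ⟨⟨C, hC⟩, h⟩ := exists_lt_of_ciInf_lt
    (f := fun C : {C : Matrix U (Fin d) ℝ // C.rank ≤ k} => frobSq (restrictRows B U - C.1))
    (lt_add_of_pos_right (rankTailSq k (restrictRows B U)) hε)
  refine ⟨rowspace C, (finrank_rowspace C).trans_le hC, lt_of_le_of_lt ?_ h⟩
  rw [frobSq_eq_sum_norm_row, ← Finset.sum_coe_sort U]
  refine Finset.sum_le_sum fun i _ => pow_le_pow_left₀ distTo_nonneg ?_ 2
  have hi : row C i ∈ rowspace C := Submodule.subset_span (Set.mem_range_self i)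
  have heq : row (restrictRows B U - C) i = row B i - row C i := rfl
  rw [heq]
  exact distTo_le_norm_sub hi

variable {B U}

theorem rankTailSq_mono {T : Finset (Fin n)} (h : U ⊆ T) :
    rankTailSq k (restrictRows B U) ≤ rankTailSq k (restrictRows B T) := by
  refine le_of_forall_pos_le_add fun ε hε => ?_
  obtain ⟨V, hV, hlt⟩ := exists_sum_distTo_lt (k := k) B T hε
  refine (rankTailSq_le_sum_distTo B U hV).trans (le_trans ?_ hlt.le)
  exact Finset.sum_le_sum_of_subset_of_nonneg h fun _ _ _ => sq_nonneg _

theorem exists_mem_orthogonal_of_finrank_lt {V W : Submodule ℝ (EuclideanSpace ℝ (Fin d))}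
    (h : Module.finrank ℝ V < Module.finrank ℝ W) : ∃ x ∈ W, x ∈ Vᗮ ∧ x ≠ 0 := by
  have h1 := Submodule.finrank_sup_add_finrank_inf_eq W Vᗮ
  have h2 := V.finrank_add_finrank_orthogonal
  have h3 := Submodule.finrank_le (W ⊔ Vᗮ)
  have h4 : 0 < Module.finrank ℝ ↥(W ⊓ Vᗮ) := by omega
  obtain ⟨x, hx, hx0⟩ := (Submodule.ne_bot_iff _).mp (Submodule.one_le_finrank_iff.mp h4)
  exact ⟨x, hx.1, hx.2, hx0⟩

/-- Courant–Fischer: by dimension, `W` contains a nonzero vector orthogonal to `V`, and on `Vᗮ` the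
form sees only the components of the rows off `V`. -/
theorem le_sum_distTo_of_rowForm {ι : Type*} {b : ι → EuclideanSpace ℝ (Fin d)} {U : Finset ι}
    {V W : Submodule ℝ (EuclideanSpace ℝ (Fin d))}
    (h : Module.finrank ℝ V < Module.finrank ℝ W) {c : ℝ}
    (hc : ∀ x ∈ W, c * ‖x‖ ^ 2 ≤ rowForm b U x) : c ≤ ∑ i ∈ U, distTo V (b i) ^ 2 := by
  obtain ⟨x, hxW, hxV, hx0⟩ := exists_mem_orthogonal_of_finrank_lt h
  have hpos : 0 < ‖x‖ ^ 2 := by positivity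
  exact le_of_mul_le_mul_right ((hc x hxW).trans (rowForm_le_sum_distTo hxV)) hpos

theorem le_rankTailSq {W : Submodule ℝ (EuclideanSpace ℝ (Fin d))}
    (hW : k < Module.finrank ℝ W) {c : ℝ}
    (hc : ∀ x ∈ W, c * ‖x‖ ^ 2 ≤ rowForm (row B) U x) :
    c ≤ rankTailSq k (restrictRows B U) := by
  refine le_of_forall_pos_le_add fun ε hε => ?_
  obtain ⟨V, hV, hlt⟩ := exists_sum_distTo_lt (k := k) B U hε
  exact (le_sum_distTo_of_rowForm (hV.trans_lt hW) hc).trans hlt.le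

theorem rankTailSq_eq_zero_iff :
    rankTailSq k (restrictRows B U) = 0 ↔
      Module.finrank ℝ (Submodule.span ℝ (row B '' (U : Set (Fin n)))) ≤ k := by
  constructor
  · intro h
    by_contra! hlt
    obtain ⟨c, hc, hcle⟩ := exists_antilipschitz_rowForm (row B) U
    linarith [le_rankTailSq hlt hcle]
  · intro h
    refine le_antisymm ((rankTailSq_le_sum_distTo B U h).trans_eq ?_) (rankTailSq_nonneg _)
    refine Finset.sum_eq_zero fun i hi => ?_
    rw [distTo_eq_zero_iff.mpr (Submodule.subset_span (Set.mem_image_of_mem _ hi))]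
    norm_num

end Tail

/-! ### Ridge scores -/

section Ridge

variable {d : ℕ}

theorem sq_dotProduct_mulVec_le {M : Matrix (Fin d) (Fin d) ℝ} (hM : M.transpose = M)
    (hpos : ∀ x, 0 ≤ x ⬝ᵥ M.mulVec x) (x y : Fin d → ℝ) :
    (x ⬝ᵥ M.mulVec y) ^ 2 ≤ (x ⬝ᵥ M.mulVec x) * (y ⬝ᵥ M.mulVec y) := by
  have hsymm : y ⬝ᵥ M.mulVec x = x ⬝ᵥ M.mulVec y := by
    conv_lhs => rw [← hM]
    rw [Matrix.mulVec_transpose, dotProduct_comm, Matrix.dotProduct_mulVec]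
  have h : ∀ s : ℝ, 0 ≤ (y ⬝ᵥ M.mulVec y) * (s * s) + (2 * (x ⬝ᵥ M.mulVec y)) * s +
      x ⬝ᵥ M.mulVec x := by
    intro s
    have := hpos (x + s • y)
    simp only [Matrix.mulVec_add, Matrix.mulVec_smul, dotProduct_add, add_dotProduct,
      dotProduct_smul, smul_dotProduct, smul_eq_mul, hsymm] at this
    linarith
  have := discrim_le_zero h
  rw [discrim] at this
  linarith

theorem IsMoorePenrose.transpose_eq {M X : Matrix (Fin d) (Fin d) ℝ} (hM : M.transpose = M)
    (h : IsMoorePenrose M X) : X.transpose = X := by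
  refine IsMoorePenrose.unique (M := M) ⟨?_, ?_, ?_, ?_⟩ h
  · simpa [Matrix.transpose_mul, hM, Matrix.mul_assoc] using congrArg Matrix.transpose h.1
  · simpa [Matrix.transpose_mul, hM, Matrix.mul_assoc] using congrArg Matrix.transpose h.2
  · simpa [Matrix.transpose_mul, hM] using h.symm_right.symm
  · simpa [Matrix.transpose_mul, hM] using h.symm_left.symm

/-- The hypothesis `ha` puts `a` in the range of `M`: the residual `z = a - M X a` is killed by `M`,
because `M` and `X` commute, and is then orthogonal to itself. So `a = M y` with `y = X a`, and
Cauchy–Schwarz for the form `M` applies to `x` and `y`. -/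
theorem sq_dotProduct_le_of_pinv {M X : Matrix (Fin d) (Fin d) ℝ} (hM : M.transpose = M)
    (hpos : ∀ x, 0 ≤ x ⬝ᵥ M.mulVec x) (hX : IsMoorePenrose M X) {a : Fin d → ℝ}
    (ha : ∀ z, z ⬝ᵥ M.mulVec z = 0 → z ⬝ᵥ a = 0) (x : Fin d → ℝ) :
    (x ⬝ᵥ a) ^ 2 ≤ (a ⬝ᵥ X.mulVec a) * (x ⬝ᵥ M.mulVec x) := by
  have hXs := hX.transpose_eq hM
  set y := X.mulVec a with hy
  set z := a - M.mulVec y with hz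
  have hMz : M.mulVec z = 0 := by
    have h1 : M * (M * X) = M := by
      have h2 : M * X = X * M := by
        rw [← hX.symm_left, Matrix.transpose_mul, hM, hXs]
      rw [h2, ← Matrix.mul_assoc, hX.mul_mul_self]
    rw [hz, hy, Matrix.mulVec_sub, Matrix.mulVec_mulVec, Matrix.mulVec_mulVec, Matrix.mul_assoc, h1, sub_self]
  have hza : z ⬝ᵥ a = 0 := ha z (by rw [hMz, dotProduct_zero])
  have hzM : z ⬝ᵥ M.mulVec y = 0 := by
    rw [Matrix.dotProduct_mulVec, ← Matrix.mulVec_transpose, hM, hMz, zero_dotProduct]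
  have hzz : z ⬝ᵥ z = 0 := by
    conv_lhs => rw [hz]
    rw [dotProduct_sub, hza, hzM, sub_zero]
  have hz0 : a = M.mulVec y := sub_eq_zero.mp (dotProduct_self_eq_zero.mp hzz)
  have hay : a ⬝ᵥ y = y ⬝ᵥ M.mulVec y := by rw [dotProduct_comm, ← hz0]
  rw [hay, mul_comm]
  conv_lhs => rw [hz0]
  exact sq_dotProduct_mulVec_le hM hpos x y

theorem pinv_mulVec_dotProduct {M X : Matrix (Fin d) (Fin d) ℝ} (hM : M.transpose = M)
    (hX : IsMoorePenrose M X) (a : Fin d → ℝ) :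
    X.mulVec a ⬝ᵥ M.mulVec (X.mulVec a) = a ⬝ᵥ X.mulVec a := by
  have hXs := hX.transpose_eq hM
  conv_lhs => enter [1]; rw [← hXs]
  rw [Matrix.mulVec_transpose, ← Matrix.dotProduct_mulVec, Matrix.mulVec_mulVec,
    Matrix.mulVec_mulVec, hX.mul_mul_inv]

variable {n : ℕ} (B : Matrix (Fin n) (Fin d) ℝ) (U : Finset (Fin n)) {lam : ℝ}

theorem inner_row_eq_dotProduct {ι : Type*} (C : Matrix ι (Fin d) ℝ) (i : ι)
    (x : EuclideanSpace ℝ (Fin d)) : inner ℝ (row C i) x = x.ofLp ⬝ᵥ C i := by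
  rw [EuclideanSpace.inner_eq_star_dotProduct, row, star_trivial]

theorem dotProduct_gram_mulVec (lam : ℝ) (x : EuclideanSpace ℝ (Fin d)) :
    x.ofLp ⬝ᵥ ((restrictRows B U).transpose * restrictRows B U + lam • 1).mulVec x.ofLp =
      rowForm (row B) U x + lam * ‖x‖ ^ 2 := by
  rw [Matrix.add_mulVec, dotProduct_add, ← Matrix.mulVec_mulVec, Matrix.mulVec_transpose,
    dotProduct_comm, ← Matrix.dotProduct_mulVec, Matrix.smul_mulVec, Matrix.one_mulVec,
    dotProduct_smul, smul_eq_mul]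
  congr 1
  · rw [rowForm, ← Finset.sum_coe_sort U, dotProduct]
    refine Finset.sum_congr rfl fun i _ => ?_
    rw [inner_row_eq_dotProduct, sq, dotProduct_comm]
    rfl
  · rw [EuclideanSpace.norm_sq_eq, dotProduct]
    simp [sq]

theorem gram_transpose (lam : ℝ) :
    ((restrictRows B U).transpose * restrictRows B U + lam • 1).transpose =
      (restrictRows B U).transpose * restrictRows B U + lam • 1 := by
  simp [Matrix.transpose_add, Matrix.transpose_mul]

theorem isMoorePenrose_gram (lam : ℝ) :
    IsMoorePenrose ((restrictRows B U).transpose * restrictRows B U + lam • 1)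
      (pinv ((restrictRows B U).transpose * restrictRows B U + lam • 1)) :=
  isMoorePenrose_pinv (by
    rw [Matrix.IsHermitian, Matrix.conjTranspose_eq_transpose_of_trivial, gram_transpose])

theorem exists_of_le_ridgeScore (t : Fin n)
    (h : 1 / 2 ≤ ridgeScore (restrictRows B U) lam (B t)) :
    ∃ x : EuclideanSpace ℝ (Fin d), inner ℝ (row B t) x ≠ 0 ∧
      rowForm (row B) U x + lam * ‖x‖ ^ 2 ≤ 2 * inner ℝ (row B t) x ^ 2 := by
  have hX := isMoorePenrose_gram B U lam
  have h1 := pinv_mulVec_dotProduct (gram_transpose B U lam) hX (B t)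
  set q := ridgeScore (restrictRows B U) lam (B t) with hq
  -- The witness is the pseudoinverse applied to the row. There the regularized form and the inner
  -- product with the row both equal the score `q`, and `q ≤ 2 q²` as `q ≥ 1/2`.
  refine ⟨WithLp.toLp 2 ((pinv ((restrictRows B U).transpose * restrictRows B U +
    lam • 1)).mulVec (B t)), ?_, ?_⟩
  · rw [inner_row_eq_dotProduct, dotProduct_comm]
    change q ≠ 0
    linarith
  · rw [inner_row_eq_dotProduct, ← dotProduct_gram_mulVec, dotProduct_comm _ (B t)]
    rw [h1]
    change q ≤ 2 * q ^ 2
    nlinarith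

/-- The hypothesis `hspan` is what excludes the failure of the pseudoinverse for `lam = 0`, where a
row outside the span could have a small score. For `lam > 0` the regularized form is definite. -/
theorem inner_sq_le_of_ridgeScore_lt_one (t : Fin n) (hlam : 0 ≤ lam)
    (hspan : lam = 0 → row B t ∈ Submodule.span ℝ (row B '' (U : Set (Fin n))))
    (h : ridgeScore (restrictRows B U) lam (B t) ≤ 1) (x : EuclideanSpace ℝ (Fin d)) :
    inner ℝ (row B t) x ^ 2 ≤ rowForm (row B) U x + lam * ‖x‖ ^ 2 := by
  have hpos : ∀ x : EuclideanSpace ℝ (Fin d), 0 ≤ rowForm (row B) U x + lam * ‖x‖ ^ 2 :=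
    fun x => add_nonneg rowForm_nonneg (by positivity)
  have key := sq_dotProduct_le_of_pinv (gram_transpose B U lam)
    (fun x => by
      have := dotProduct_gram_mulVec B U lam (WithLp.toLp 2 x)
      dsimp only at this
      rw [this]; exact hpos _)
    (isMoorePenrose_gram B U lam) (a := B t) (fun z hz => by
      have h0 := dotProduct_gram_mulVec B U lam (WithLp.toLp 2 z)
      dsimp only at h0
      rw [hz] at h0
      have h1 := inner_row_eq_dotProduct B t (WithLp.toLp 2 z)
      dsimp only at h1
      rw [← h1]
      rcases hlam.eq_or_lt with h2 | h2
      · rw [← h2, zero_mul, add_zero] at h0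
        exact Submodule.inner_right_of_mem_orthogonal (hspan h2.symm)
          (mem_orthogonal_span_of_rowForm_eq_zero h0.symm)
      · have h3 : lam * ‖(WithLp.toLp 2 z : EuclideanSpace ℝ (Fin d))‖ ^ 2 = 0 :=
          le_antisymm (by linarith [rowForm_nonneg (b := row B) (U := U) (x := WithLp.toLp 2 z)])
            (by positivity)
        have h4 : (WithLp.toLp 2 z : EuclideanSpace ℝ (Fin d)) = 0 := by
          simpa [h2.ne'] using h3
        rw [h4, inner_zero_right]) x.ofLp
  rw [dotProduct_gram_mulVec] at key
  rw [inner_row_eq_dotProduct]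
  exact key.trans (mul_le_of_le_one_left (hpos x) h)

end Ridge

/-! ### The selected set -/

section Coreset

variable {n d k : ℕ} {B : Matrix (Fin n) (Fin d) ℝ}

/-- The rows of `coreset k B` that precede row `t`. -/
noncomputable def before (k : ℕ) (B : Matrix (Fin n) (Fin d) ℝ) (t : ℕ) : Finset (Fin n) :=
  (coreset k B).filter fun i => (i : ℕ) < t

/-- The regularization parameter after the rows preceding `t` have been processed. -/
noncomputable def lamAt (k : ℕ) (B : Matrix (Fin n) (Fin d) ℝ) (t : ℕ) : ℝ :=
  rankTailSq k (restrictRows B (before k B t)) / k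

/-- The state of the algorithm after `m` rows. -/
noncomputable def stateAt (k : ℕ) (B : Matrix (Fin n) (Fin d) ℝ) (m : ℕ) : Finset (Fin n) × ℝ :=
  ((List.finRange n).take m).foldl (coresetStep k B) (∅, 0)

theorem stateAt_succ {m : ℕ} (hm : m < n) :
    stateAt k B (m + 1) = coresetStep k B (stateAt k B m) ⟨m, hm⟩ := by
  rw [stateAt, stateAt, List.take_add_one, List.foldl_append]
  simp [hm]

theorem stateAt_top : (stateAt k B n).1 = coreset k B := by
  rw [stateAt, coreset, List.take_of_length_le (by simp)]

theorem mem_selectRow {S : Finset (Fin n)} {lam : ℝ} {t i : Fin n} (h : i ≠ t) :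
    i ∈ selectRow k B S lam t ↔ i ∈ S := by
  rw [selectRow]
  split_ifs <;> simp [h]

theorem mem_stateAt_succ {m : ℕ} (hm : m < n) {i : Fin n} (h : (i : ℕ) ≠ m) :
    i ∈ (stateAt k B (m + 1)).1 ↔ i ∈ (stateAt k B m).1 := by
  rw [stateAt_succ hm]
  exact mem_selectRow fun hi => h (by rw [hi])

theorem lt_of_mem_stateAt {m : ℕ} (hm : m ≤ n) {i : Fin n} (h : i ∈ (stateAt k B m).1) :
    (i : ℕ) < m := by
  induction m with
  | zero => simp [stateAt] at h
  | succ m ih =>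
    by_cases him : (i : ℕ) = m
    · omega
    · rw [mem_stateAt_succ hm him] at h
      have := ih (by omega) h
      omega

theorem mem_stateAt_iff_of_le {m m' : ℕ} (hmm : m ≤ m') (hm' : m' ≤ n) {i : Fin n}
    (hi : (i : ℕ) < m) : i ∈ (stateAt k B m').1 ↔ i ∈ (stateAt k B m).1 := by
  induction m', hmm using Nat.le_induction with
  | base => rfl
  | succ j hj ih => rw [mem_stateAt_succ hm' (by omega), ih (by omega)]

/-- The decision on a row is never revised, so every intermediate state can be read off from the
final set. From here on the run of the algorithm is described by `before` and `lamAt` alone. -/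
theorem stateAt_fst {m : ℕ} (hm : m ≤ n) : (stateAt k B m).1 = before k B m := by
  ext i
  rw [before, Finset.mem_filter, ← stateAt_top]
  constructor
  · intro h
    have hi := lt_of_mem_stateAt hm h
    exact ⟨(mem_stateAt_iff_of_le hm le_rfl hi).mpr h, hi⟩
  · rintro ⟨h, hi⟩
    exact (mem_stateAt_iff_of_le hm le_rfl hi).mp h

theorem stateAt_snd {m : ℕ} (hm : m ≤ n) : (stateAt k B m).2 = lamAt k B m := by
  rw [lamAt, ← stateAt_fst hm]
  cases m with
  | zero =>
    have h : rankTailSq k (restrictRows B (∅ : Finset (Fin n))) = 0 := by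
      rw [rankTailSq_eq_zero_iff, Finset.coe_empty, Set.image_empty, Submodule.span_empty,
        finrank_bot]
      exact Nat.zero_le k
    change (0 : ℝ) = rankTailSq k (restrictRows B ∅) / k
    rw [h, zero_div]
  | succ m => rw [stateAt_succ hm]; rfl

theorem lamAt_nonneg (t : ℕ) : 0 ≤ lamAt k B t :=
  div_nonneg (rankTailSq_nonneg _) (Nat.cast_nonneg k)

theorem before_subset (t : ℕ) : before k B t ⊆ coreset k B := Finset.filter_subset _ _

theorem before_mono {s t : ℕ} (h : s ≤ t) : before k B s ⊆ before k B t :=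
  Finset.monotone_filter_right _ fun _ _ hi => lt_of_lt_of_le hi h

theorem lamAt_mono {s t : ℕ} (h : s ≤ t) : lamAt k B s ≤ lamAt k B t :=
  div_le_div_of_nonneg_right (rankTailSq_mono (before_mono h)) (Nat.cast_nonneg k)

theorem before_top : before k B n = coreset k B :=
  Finset.filter_true_of_mem fun i _ => i.2

open Classical in
theorem mem_coreset_iff (t : Fin n) :
    t ∈ coreset k B ↔
      (lamAt k B t = 0 ∧
        row B t ∉ Submodule.span ℝ (row B '' (before k B t : Set (Fin n)))) ∨
      1 / (1 + 1 / (k : ℝ)) ≤ ridgeScore (restrictRows B (before k B t)) (lamAt k B t) (B t) := by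
  have h1 : t ∈ coreset k B ↔ t ∈ (stateAt k B (t + 1)).1 := by
    rw [← stateAt_top]
    exact mem_stateAt_iff_of_le t.2 le_rfl (Nat.lt_succ_self _)
  have h2 : t ∉ before k B t := by simp [before]
  rw [h1, stateAt_succ t.2, coresetStep, stateAt_fst t.2.le, stateAt_snd t.2.le, selectRow,
    rowspace_restrictRows]
  simp only [Fin.eta]
  split_ifs with h3 h4
  · simp [h3]
  · simp only [Finset.mem_insert_self, true_iff]
    exact Or.inr h4
  · simp only [h2, false_iff]
    tauto

theorem inner_sq_le_of_notMem_coreset {t : Fin n} (ht : t ∉ coreset k B)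
    (x : EuclideanSpace ℝ (Fin d)) :
    inner ℝ (row B t) x ^ 2 ≤
      rowForm (row B) (before k B t) x + lamAt k B t * ‖x‖ ^ 2 := by
  rw [mem_coreset_iff] at ht
  push Not at ht
  refine inner_sq_le_of_ridgeScore_lt_one _ _ _ (lamAt_nonneg _) ht.1 (ht.2.le.trans ?_) x
  rw [div_le_one (by positivity)]
  linarith [show (0 : ℝ) ≤ 1 / k by positivity]

theorem exists_of_mem_coreset (hk : 1 ≤ k) {t : Fin n} (ht : t ∈ coreset k B) :
    (lamAt k B t = 0 ∧
        row B t ∉ Submodule.span ℝ (row B '' (before k B t : Set (Fin n)))) ∨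
      ∃ x : EuclideanSpace ℝ (Fin d), inner ℝ (row B t) x ≠ 0 ∧
        rowForm (row B) (before k B t) x + lamAt k B t * ‖x‖ ^ 2 ≤
          2 * inner ℝ (row B t) x ^ 2 := by
  refine ((mem_coreset_iff t).mp ht).imp_right fun h => ?_
  refine exists_of_le_ridgeScore _ _ _ (le_trans ?_ h)
  have hk' : (1 : ℝ) ≤ k := by exact_mod_cast hk
  -- As `k ≥ 1`, the threshold `1 / (1 + 1/k)` is at least `1/2`.
  apply one_div_le_one_div_of_le (by positivity)
  linarith [(div_le_one (by linarith)).mpr hk']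

end Coreset

/-! ### Rank-one updates of determinants -/

section Determinant

variable {d : ℕ} {M N : Matrix (Fin d) (Fin d) ℝ} {v : Fin d → ℝ}

theorem dotProduct_vecMulVec_mulVec (v x y : Fin d → ℝ) :
    x ⬝ᵥ (Matrix.vecMulVec v v).mulVec y = (v ⬝ᵥ x) * (v ⬝ᵥ y) := by
  rw [Matrix.vecMulVec_mulVec, op_smul_eq_smul, dotProduct_smul, smul_eq_mul, dotProduct_comm x v,
    mul_comm]

theorem dotProduct_vecMulVec_mulVec_self (v x : Fin d → ℝ) :
    x ⬝ᵥ (Matrix.vecMulVec v v).mulVec x = (v ⬝ᵥ x) ^ 2 := by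
  rw [dotProduct_vecMulVec_mulVec, sq]

theorem det_add_vecMulVec (hM : M.PosDef) (v : Fin d → ℝ) :
    (M + Matrix.vecMulVec v v).det = M.det * (1 + v ⬝ᵥ M⁻¹.mulVec v) := by
  rw [Matrix.vecMulVec_eq Unit, Matrix.det_add_replicateCol_mul_replicateRow
    ((Matrix.isUnit_iff_isUnit_det _).mp hM.isUnit), Matrix.det_unique (n := Unit)]
  rw [Matrix.add_apply, Matrix.one_apply_eq, Matrix.mul_assoc, ← Matrix.replicateCol_mulVec,
    Matrix.replicateRow_mul_replicateCol_apply]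

theorem posSemidef_vecMulVec (v : Fin d → ℝ) : (Matrix.vecMulVec v v).PosSemidef := by
  simpa using Matrix.posSemidef_vecMulVec_self_star v

theorem posDef_quadForm_nonneg (hM : M.PosDef) (x : Fin d → ℝ) : 0 ≤ x ⬝ᵥ M.mulVec x := by
  simpa using hM.posSemidef.dotProduct_mulVec_nonneg x

theorem mulVec_inv_mulVec (hM : M.PosDef) (v : Fin d → ℝ) : M.mulVec (M⁻¹.mulVec v) = v := by
  rw [Matrix.mulVec_mulVec, Matrix.mul_nonsing_inv _
    ((Matrix.isUnit_iff_isUnit_det _).mp hM.isUnit), Matrix.one_mulVec]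

theorem PosDef.transpose_eq (hM : M.PosDef) : M.transpose = M := by
  simpa [Matrix.IsHermitian, Matrix.conjTranspose_eq_transpose_of_trivial] using hM.isHermitian

/-- Cauchy–Schwarz for the form `M`, applied to `x` and `M⁻¹ v`. Any test vector thus bounds the
leverage `vᵀ M⁻¹ v` from below, with no need to compute the inverse. -/
theorem le_dotProduct_inv_mulVec (hM : M.PosDef) {x : Fin d → ℝ} {c : ℝ} (hx : v ⬝ᵥ x ≠ 0)
    (h : c * (x ⬝ᵥ M.mulVec x) ≤ (v ⬝ᵥ x) ^ 2) : c ≤ v ⬝ᵥ M⁻¹.mulVec v := by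
  have hx0 : x ≠ 0 := by rintro rfl; simp at hx
  have hpos : 0 < x ⬝ᵥ M.mulVec x := by simpa using hM.dotProduct_mulVec_pos hx0
  have h1 := sq_dotProduct_mulVec_le (PosDef.transpose_eq hM) (posDef_quadForm_nonneg hM) x
    (M⁻¹.mulVec v)
  rw [mulVec_inv_mulVec hM, dotProduct_comm x v, dotProduct_comm _ v] at h1
  refine le_of_mul_le_mul_right ((h.trans h1).trans_eq (mul_comm _ _)) hpos

theorem dotProduct_inv_mulVec_le (hM : M.PosDef) {μ : ℝ} (hμ : 0 < μ)
    (h : ∀ x, μ * (x ⬝ᵥ x) ≤ x ⬝ᵥ M.mulVec x) : v ⬝ᵥ M⁻¹.mulVec v ≤ v ⬝ᵥ v / μ := by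
  set y := M⁻¹.mulVec v with hy
  have h1 := h y
  rw [hy, mulVec_inv_mulVec hM, ← hy] at h1
  have h2 : (v ⬝ᵥ y) ^ 2 ≤ (v ⬝ᵥ v) * (y ⬝ᵥ y) := by
    simpa using sq_dotProduct_mulVec_le (M := 1) (by simp)
      (fun x => by rw [Matrix.one_mulVec]; exact dotProduct_self_star_nonneg x) v y
  rw [dotProduct_comm y v] at h1
  have h3 : 0 ≤ v ⬝ᵥ v := dotProduct_self_star_nonneg v
  have h4 : 0 ≤ y ⬝ᵥ y := dotProduct_self_star_nonneg y
  rw [le_div_iff₀ hμ]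
  by_contra! hlt
  have h5 : 0 < v ⬝ᵥ y := by nlinarith
  nlinarith

theorem det_le_det_add_sum (hM : M.PosDef) {ι : Type*} (s : Finset ι) (w : ι → Fin d → ℝ) :
    (M + ∑ i ∈ s, Matrix.vecMulVec (w i) (w i)).PosDef ∧
      M.det ≤ (M + ∑ i ∈ s, Matrix.vecMulVec (w i) (w i)).det := by
  classical
  induction s using Finset.induction_on with
  | empty => simpa using hM
  | insert a s ha ih =>
    rw [Finset.sum_insert ha, add_comm (Matrix.vecMulVec _ _), ← add_assoc]
    refine ⟨ih.1.add_posSemidef (posSemidef_vecMulVec _), ih.2.trans ?_⟩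
    rw [det_add_vecMulVec ih.1]
    have h0 : 0 ≤ w a ⬝ᵥ (M + ∑ i ∈ s, Matrix.vecMulVec (w i) (w i))⁻¹.mulVec (w a) :=
      posDef_quadForm_nonneg ih.1.inv _
    exact le_mul_of_one_le_right ih.1.det_pos.le (by linarith)

open scoped MatrixOrder in
-- A positive semidefinite difference is a sum of rank-one terms, none of which lowers the
-- determinant.
theorem det_le_det_of_posSemidef_sub (hM : M.PosDef) (h : (N - M).PosSemidef) :
    M.det ≤ N.det := by
  obtain ⟨C, hC⟩ := CStarAlgebra.nonneg_iff_eq_star_mul_self.mp (Matrix.nonneg_iff_posSemidef.mpr h)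
  have hsum : N = M + ∑ i, Matrix.vecMulVec (C i) (C i) := by
    rw [← sub_eq_iff_eq_add', hC]
    ext i j
    simp [Matrix.mul_apply, Matrix.sum_apply, Matrix.vecMulVec_apply]
  rw [hsum]
  exact (det_le_det_add_sum hM _ _).2

/-- The matrix `μ I + ∑_{i ∈ U} b_i b_iᵀ`. -/
noncomputable def ridgeGram {ι : Type*} (μ : ℝ) (b : ι → EuclideanSpace ℝ (Fin d))
    (U : Finset ι) : Matrix (Fin d) (Fin d) ℝ :=
  μ • 1 + ∑ i ∈ U, Matrix.vecMulVec (b i).ofLp (b i).ofLp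

variable {ι : Type*} {μ : ℝ} {b : ι → EuclideanSpace ℝ (Fin d)} {U : Finset ι}

theorem dotProduct_ridgeGram_mulVec (x : EuclideanSpace ℝ (Fin d)) :
    x.ofLp ⬝ᵥ (ridgeGram μ b U).mulVec x.ofLp = μ * ‖x‖ ^ 2 + rowForm b U x := by
  rw [ridgeGram, Matrix.add_mulVec, dotProduct_add, Matrix.smul_mulVec, Matrix.one_mulVec,
    dotProduct_smul, smul_eq_mul, Matrix.sum_mulVec, dotProduct_sum, rowForm]
  congr 1
  · rw [EuclideanSpace.norm_sq_eq, dotProduct]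
    simp [sq]
  · refine Finset.sum_congr rfl fun i _ => ?_
    rw [dotProduct_vecMulVec_mulVec_self, EuclideanSpace.inner_eq_star_dotProduct, star_trivial,
      dotProduct_comm]

theorem posDef_ridgeGram (hμ : 0 < μ) : (ridgeGram μ b U).PosDef := by
  have h : (μ • (1 : Matrix (Fin d) (Fin d) ℝ)).PosDef := Matrix.PosDef.one.smul hμ
  exact (det_le_det_add_sum h _ _).1

theorem ridgeGram_insert [DecidableEq ι] {t : ι} (ht : t ∉ U) :
    ridgeGram μ b (insert t U) = ridgeGram μ b U + Matrix.vecMulVec (b t).ofLp (b t).ofLp := by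
  rw [ridgeGram, ridgeGram, Finset.sum_insert ht, add_comm (Matrix.vecMulVec _ _), ← add_assoc]

theorem det_ridgeGram_empty : (ridgeGram μ b ∅).det = μ ^ d := by
  simp [ridgeGram]

/-- The rows enter in increasing order. A row with property `Q` has leverage at least `1/4` over its
predecessors in `U`, hence multiplies the determinant by at least `5/4`; the other rows do not lower
it. -/
theorem pow_mul_le_det_ridgeGram [LinearOrder ι] (hμ : 0 < μ) (Q : ι → Prop) [DecidablePred Q]
    (h : ∀ t ∈ U, Q t → ∃ x, inner ℝ (b t) x ≠ 0 ∧
      μ * ‖x‖ ^ 2 + rowForm b (U.filter (· < t)) x ≤ 4 * inner ℝ (b t) x ^ 2) :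
    μ ^ d * (5 / 4 : ℝ) ^ (U.filter Q).card ≤ (ridgeGram μ b U).det := by
  induction U using Finset.induction_on_max with
  | empty => simp [det_ridgeGram_empty]
  | insert t U hlt ih =>
    have ht : t ∉ U := fun h => lt_irrefl _ (hlt t h)
    have hfilt : (insert t U).filter (· < t) = U := by
      rw [Finset.filter_insert, if_neg (lt_irrefl t)]
      exact Finset.filter_true_of_mem hlt
    have hsub : ∀ s ∈ U, (insert t U).filter (· < s) = U.filter (· < s) := by
      intro s hs
      rw [Finset.filter_insert, if_neg (hlt s hs).le.not_gt]
    have ih' := ih fun s hs hQ => by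
      have := h s (Finset.mem_insert_of_mem hs) hQ
      rwa [hsub s hs] at this
    have hpd := posDef_ridgeGram (b := b) (U := U) hμ
    rw [ridgeGram_insert ht, det_add_vecMulVec hpd, Finset.filter_insert]
    have h0 : 0 ≤ (b t).ofLp ⬝ᵥ (ridgeGram μ b U)⁻¹.mulVec (b t).ofLp :=
      posDef_quadForm_nonneg hpd.inv _
    split_ifs with hQ
    · obtain ⟨x, hx0, hx⟩ := h t (Finset.mem_insert_self _ _) hQ
      rw [hfilt, ← dotProduct_ridgeGram_mulVec] at hx
      rw [EuclideanSpace.inner_eq_star_dotProduct, star_trivial, dotProduct_comm x.ofLp (b t).ofLp]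
        at hx0 hx
      have h1 : 1 / 4 ≤ (b t).ofLp ⬝ᵥ (ridgeGram μ b U)⁻¹.mulVec (b t).ofLp :=
        le_dotProduct_inv_mulVec hpd hx0 (by linarith)
      rw [Finset.card_insert_of_notMem (by simp [ht]), pow_succ, ← mul_assoc]
      exact mul_le_mul ih' (by linarith) (by norm_num) hpd.det_pos.le
    · exact ih'.trans (le_mul_of_one_le_right hpd.det_pos.le (by linarith))

/-- Every rank-one update has leverage at most `‖b i‖² / μ`, because the matrix already present
dominates `μ I`. -/
theorem det_ridgeGram_le_prod (hμ : 0 < μ) :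
    (ridgeGram μ b U).det ≤ μ ^ d * ∏ i ∈ U, (1 + ‖b i‖ ^ 2 / μ) := by
  classical
  induction U using Finset.induction_on with
  | empty => simp [det_ridgeGram_empty]
  | insert t U ht ih =>
    have hpd := posDef_ridgeGram (b := b) (U := U) hμ
    rw [ridgeGram_insert ht, det_add_vecMulVec hpd, Finset.prod_insert ht,
      mul_comm (1 + ‖b t‖ ^ 2 / μ), ← mul_assoc]
    have h0 : 0 ≤ (b t).ofLp ⬝ᵥ (ridgeGram μ b U)⁻¹.mulVec (b t).ofLp :=
      posDef_quadForm_nonneg hpd.inv _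
    have hself : ∀ x : EuclideanSpace ℝ (Fin d), x.ofLp ⬝ᵥ x.ofLp = ‖x‖ ^ 2 := fun x => by
      rw [EuclideanSpace.norm_sq_eq, dotProduct]
      simp [sq]
    have h1 := dotProduct_inv_mulVec_le (v := (b t).ofLp) hpd hμ (fun x => by
      have h2 := dotProduct_ridgeGram_mulVec (μ := μ) (b := b) (U := U) (WithLp.toLp 2 x)
      dsimp only at h2
      rw [h2, ← hself]
      exact le_add_of_nonneg_right rowForm_nonneg)
    rw [hself] at h1
    exact mul_le_mul ih (by linarith) (by linarith)
      (mul_nonneg (by positivity) (Finset.prod_nonneg fun i _ => by positivity))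

theorem det_ridgeGram_le_of_rowForm_le {κ : Type*} {c : κ → EuclideanSpace ℝ (Fin d)}
    {T : Finset κ} (hμ : 0 < μ) (h : ∀ x, rowForm b U x ≤ rowForm c T x) :
    (ridgeGram μ b U).det ≤ (ridgeGram μ c T).det := by
  refine det_le_det_of_posSemidef_sub (posDef_ridgeGram hμ) ?_
  refine Matrix.PosSemidef.of_dotProduct_mulVec_nonneg
    ((posDef_ridgeGram hμ).isHermitian.sub (posDef_ridgeGram hμ).isHermitian) fun x => ?_
  have h1 := dotProduct_ridgeGram_mulVec (μ := μ) (b := b) (U := U) (WithLp.toLp 2 x)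
  have h2 := dotProduct_ridgeGram_mulVec (μ := μ) (b := c) (U := T) (WithLp.toLp 2 x)
  dsimp only at h1 h2
  rw [star_trivial, Matrix.sub_mulVec, dotProduct_sub, h1, h2]
  linarith [h (WithLp.toLp 2 x)]

/-- Splitting each row along `V` and `Vᗮ` and using `(a + b)² ≤ 2a² + 2b²`, the form is dominated by
that of `√(2F)` times an orthonormal basis of `V` together with `√2` times the residual rows. The at
most `k` large vectors produce the power, and the residuals, whose total squared length is at most
`2τ`, only an exponential factor. -/
theorem det_ridgeGram_le (hμ : 0 < μ) {k : ℕ} {F τ : ℝ}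
    (hF : ∑ i ∈ U, ‖b i‖ ^ 2 ≤ F) {V : Submodule ℝ (EuclideanSpace ℝ (Fin d))}
    (hV : Module.finrank ℝ V ≤ k) (hτ : ∑ i ∈ U, distTo V (b i) ^ 2 ≤ τ) :
    (ridgeGram μ b U).det ≤ μ ^ d * ((1 + 2 * F / μ) ^ k * Real.exp (2 * τ / μ)) := by
  have hF0 : 0 ≤ F := (Finset.sum_nonneg fun i _ => sq_nonneg _).trans hF
  let v := stdOrthonormalBasis ℝ V
  let c : Fin (Module.finrank ℝ V) ⊕ ι → EuclideanSpace ℝ (Fin d) :=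
    Sum.elim (fun j => √(2 * F) • (v j : EuclideanSpace ℝ (Fin d)))
      (fun i => √2 • (b i - V.starProjection (b i)))
  have hle : ∀ x, rowForm b U x ≤ rowForm c (Finset.univ.disjSum U) x := by
    intro x
    have h1 : rowForm c (Finset.univ.disjSum U) x =
        2 * F * ‖V.starProjection x‖ ^ 2 +
          ∑ i ∈ U, 2 * inner ℝ (b i - V.starProjection (b i)) x ^ 2 := by
      rw [rowForm, Finset.sum_disjSum]
      congr 1
      · have h2 := v.sum_sq_norm_inner_right (V.orthogonalProjectionOnto x)
        have h3 : ‖V.starProjection x‖ = ‖V.orthogonalProjectionOnto x‖ := rfl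
        rw [h3, ← h2, Finset.mul_sum]
        refine Finset.sum_congr rfl fun j _ => ?_
        simp only [c, Sum.elim_inl, inner_smul_left, mul_pow, Real.norm_eq_abs, sq_abs,
          conj_trivial, Real.sq_sqrt (show 0 ≤ 2 * F by positivity)]
        rw [show inner ℝ (v j) (V.orthogonalProjectionOnto x) =
          inner ℝ (v j : EuclideanSpace ℝ (Fin d)) x from by
            rw [Submodule.coe_inner]; exact V.inner_orthogonalProjectionOnto_eq_of_mem_left _ _]
      · refine Finset.sum_congr rfl fun i _ => ?_
        simp [c, inner_smul_left, mul_pow]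
    rw [h1]
    have h2 : ∀ i ∈ U, inner ℝ (b i) x ^ 2 ≤ 2 * (‖b i‖ ^ 2 * ‖V.starProjection x‖ ^ 2) +
        2 * inner ℝ (b i - V.starProjection (b i)) x ^ 2 := by
      intro i _
      have h3 : inner ℝ (b i) x = inner ℝ (b i) (V.starProjection x) +
          inner ℝ (b i - V.starProjection (b i)) x := by
        rw [← Submodule.inner_starProjection_left_eq_right, ← inner_add_left, add_sub_cancel]
      have h4 : inner ℝ (b i) (V.starProjection x) ^ 2 ≤ ‖b i‖ ^ 2 * ‖V.starProjection x‖ ^ 2 := by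
        rw [← mul_pow, ← sq_abs]
        exact pow_le_pow_left₀ (abs_nonneg _) (abs_real_inner_le_norm _ _) 2
      rw [h3]
      nlinarith [sq_nonneg (inner ℝ (b i) (V.starProjection x) -
        inner ℝ (b i - V.starProjection (b i)) x)]
    refine (Finset.sum_le_sum h2).trans ?_
    rw [Finset.sum_add_distrib, ← Finset.mul_sum, ← Finset.sum_mul]
    have := mul_le_mul_of_nonneg_right hF (sq_nonneg ‖V.starProjection x‖)
    linarith
  refine (det_ridgeGram_le_of_rowForm_le hμ hle).trans ((det_ridgeGram_le_prod hμ).trans ?_)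
  refine mul_le_mul_of_nonneg_left ?_ (by positivity)
  rw [Finset.prod_disjSum]
  have hone : 1 ≤ 1 + 2 * F / μ := le_add_of_nonneg_right (by positivity)
  refine mul_le_mul ?_ ?_ (Finset.prod_nonneg fun i _ => by positivity) (by positivity)
  · refine le_trans (le_of_eq ?_) (pow_le_pow_right₀ hone hV)
    have : ∀ j, ‖c (Sum.inl j)‖ ^ 2 = 2 * F := by
      intro j
      have hv : ‖(v j : EuclideanSpace ℝ (Fin d))‖ = 1 := v.orthonormal.1 j
      simp only [c, Sum.elim_inl, norm_smul, hv, mul_one, Real.norm_eq_abs, sq_abs,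
        Real.sq_sqrt (show 0 ≤ 2 * F by positivity)]
    simp [this]
  · have : ∀ i, ‖c (Sum.inr i)‖ ^ 2 = 2 * distTo V (b i) ^ 2 := by
      intro i
      simp [c, norm_smul, mul_pow, distTo]
    refine (Finset.prod_le_prod (fun i _ => by positivity) fun i _ =>
      (add_comm (1 : ℝ) _).trans_le (Real.add_one_le_exp _)).trans ?_
    rw [← Real.exp_sum, Real.exp_le_exp, ← Finset.sum_div]
    simp_rw [this, ← Finset.mul_sum]
    gcongr

end Determinant

/-! ### Singular values and the online condition number -/

section SingularValue

variable {ι : Type*} [Fintype ι] {d : ℕ} (B : Matrix ι (Fin d) ℝ)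

theorem norm_euclideanMap_sq (x : EuclideanSpace ℝ (Fin d)) :
    ‖euclideanMap B x‖ ^ 2 = rowForm (row B) Finset.univ x := by
  rw [EuclideanSpace.norm_sq_eq, rowForm]
  refine Finset.sum_congr rfl fun i _ => ?_
  rw [inner_row_eq_dotProduct, Real.norm_eq_abs, sq_abs, dotProduct_comm]
  rfl

theorem finrank_range_euclideanMap :
    Module.finrank ℝ (LinearMap.range (euclideanMap B)) = B.rank := by
  classical
  rw [euclideanMap, Matrix.toLpLin_eq_toLin, ← Matrix.rank_eq_finrank_range_toLin]

theorem rowForm_le_opNorm_sq (x : EuclideanSpace ℝ (Fin d)) :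
    rowForm (row B) Finset.univ x ≤ opNorm B ^ 2 * ‖x‖ ^ 2 := by
  rw [← norm_euclideanMap_sq, ← mul_pow]
  exact pow_le_pow_left₀ (norm_nonneg _)
    ((LinearMap.toContinuousLinearMap (euclideanMap B)).le_opNorm x) 2

variable {B}

theorem rank_pos_of_ne_zero (hB : B ≠ 0) : 0 < B.rank := by
  rw [Nat.pos_iff_ne_zero, ← finrank_rowspace, Ne, Submodule.finrank_eq_zero]
  intro h
  apply hB
  ext i j
  have h1 : row B i ∈ rowspace B := Submodule.subset_span (Set.mem_range_self i)
  rw [h, Submodule.mem_bot] at h1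
  simpa [row] using congrArg (fun v : EuclideanSpace ℝ (Fin d) => v.ofLp j) h1

theorem sigmaMin_pos (hB : B ≠ 0) : 0 < sigmaMin B := by
  rw [sigmaMin, LinearMap.singularValues_pos_iff_lt_finrank_range, finrank_range_euclideanMap]
  have := rank_pos_of_ne_zero hB
  omega

/-- In an eigenbasis of `TᵀT`, ordered by decreasing singular values, the eigenvectors from index
`B.rank` on lie in the kernel and are orthogonal to `x`. All others have eigenvalue at least the
square of the singular value at index `B.rank - 1`. -/
theorem sigmaMin_sq_mul_le {x : EuclideanSpace ℝ (Fin d)} (hx : x ∈ rowspace B) :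
    sigmaMin B ^ 2 * ‖x‖ ^ 2 ≤ rowForm (row B) Finset.univ x := by
  set T := euclideanMap B with hT
  have hd : Module.finrank ℝ (EuclideanSpace ℝ (Fin d)) = d := finrank_euclideanSpace_fin
  let hS := T.isSymmetric_adjoint_comp_self
  let u := hS.eigenvectorBasis hd
  have hnorm : ∀ y, ‖T y‖ ^ 2 = inner ℝ ((LinearMap.adjoint T ∘ₗ T) y) y := fun y => by
    rw [LinearMap.comp_apply, LinearMap.adjoint_inner_left, real_inner_self_eq_norm_sq]
  have hexp : ‖T x‖ ^ 2 = ∑ i, hS.eigenvalues hd i * inner ℝ (u i) x ^ 2 := by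
    rw [hnorm, ← u.sum_inner_mul_inner]
    refine Finset.sum_congr rfl fun i _ => ?_
    rw [hS, hS.apply_eigenvectorBasis hd i, inner_smul_right, real_inner_comm]
    simp only [RCLike.ofReal_real_eq_id, id_eq]
    change hS.eigenvalues hd i * inner ℝ (u i) x * inner ℝ (u i) x = _
    ring
  rw [← norm_euclideanMap_sq, ← hT, hexp, ← u.sum_sq_norm_inner_right x, Finset.mul_sum]
  refine Finset.sum_le_sum fun i _ => ?_
  rw [Real.norm_eq_abs, sq_abs]
  by_cases hi : (i : ℕ) < B.rank
  · refine mul_le_mul_of_nonneg_right ?_ (sq_nonneg _)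
    rw [← T.sq_singularValues_fin hd i]
    exact pow_le_pow_left₀ (T.singularValues_nonneg _) (T.singularValues_antitone (by omega)) 2
  · have h0 : hS.eigenvalues hd i = 0 := by
      rw [← T.sq_singularValues_fin hd i, T.singularValues_eq_zero_iff_le_finrank_range.mpr
        (by rw [hT, finrank_range_euclideanMap]; omega)]
      norm_num
    have h1 : rowForm (row B) Finset.univ (u i) = 0 := by
      rw [← norm_euclideanMap_sq, ← hT, hnorm, hS.apply_eigenvectorBasis hd i, h0]
      simp
    have h2 := mem_orthogonal_span_of_rowForm_eq_zero h1
    rw [Finset.coe_univ, Set.image_univ] at h2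
    rw [Submodule.inner_left_of_mem_orthogonal hx h2]
    simp

end SingularValue

section OnlineCondition

variable {n d k : ℕ} {A : Matrix (Fin n) (Fin d) ℝ}

/-- The indices of the first `i` rows. -/
def firstIndices (n i : ℕ) : Finset (Fin n) := Finset.univ.filter fun j => (j : ℕ) < i

/-- The span of the first `i` rows. -/
noncomputable def firstSpan (A : Matrix (Fin n) (Fin d) ℝ) (i : ℕ) :
    Submodule ℝ (EuclideanSpace ℝ (Fin d)) :=
  Submodule.span ℝ (row A '' (firstIndices n i : Set (Fin n)))

theorem rowspace_firstRows (i : ℕ) : rowspace (firstRows A i) = firstSpan A i := by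
  rw [rowspace, firstSpan]
  congr 1
  ext x
  constructor
  · rintro ⟨j, rfl⟩
    exact ⟨j, by simp [firstIndices], rfl⟩
  · rintro ⟨j, hj, rfl⟩
    exact ⟨⟨j, by simpa [firstIndices] using hj⟩, rfl⟩

theorem rank_firstRows (i : ℕ) : (firstRows A i).rank = Module.finrank ℝ (firstSpan A i) := by
  rw [← rowspace_firstRows, finrank_rowspace]

theorem rowForm_firstRows (i : ℕ) (x : EuclideanSpace ℝ (Fin d)) :
    rowForm (row (firstRows A i)) Finset.univ x = rowForm (row A) (firstIndices n i) x := by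
  rw [rowForm, rowForm, firstIndices, ← Finset.sum_subtype_eq_sum_filter]
  simp only [Finset.subtype_univ]
  rfl

theorem firstSpan_mono {i j : ℕ} (h : i ≤ j) : firstSpan A i ≤ firstSpan A j := by
  refine Submodule.span_mono (Set.image_mono ?_)
  intro t ht
  simp only [firstIndices, Finset.coe_filter, Finset.mem_univ, true_and, Set.mem_ofPred_eq] at ht ⊢
  omega

theorem firstSpan_of_le {i : ℕ} (h : n ≤ i) : firstSpan A i = rowspace A := by
  rw [firstSpan, rowspace, ← Set.image_univ]
  congr 2
  ext t
  simp only [firstIndices, Finset.coe_filter, Finset.mem_univ, true_and, Set.mem_ofPred_eq,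
    Set.mem_univ, iff_true]
  omega

theorem finrank_firstSpan_succ_le (i : ℕ) :
    Module.finrank ℝ (firstSpan A (i + 1)) ≤ Module.finrank ℝ (firstSpan A i) + 1 := by
  by_cases hi : i < n
  · have h : firstSpan A (i + 1) ≤ firstSpan A i ⊔ Submodule.span ℝ {row A ⟨i, hi⟩} := by
      rw [firstSpan, Submodule.span_le]
      rintro _ ⟨j, hj, rfl⟩
      have hj' : (j : ℕ) < i + 1 := by simpa [firstIndices] using hj
      rcases Nat.lt_succ_iff_lt_or_eq.mp hj' with h | h
      · refine Submodule.mem_sup_left (Submodule.subset_span ⟨j, ?_, rfl⟩)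
        simpa [firstIndices] using h
      · refine Submodule.mem_sup_right (Submodule.subset_span ?_)
        subst h
        rfl
    refine (Submodule.finrank_mono h).trans ((Submodule.finrank_add_le_finrank_add_finrank _ _).trans
      (Nat.add_le_add_left ?_ _))
    exact (finrank_span_le_card _).trans (by simp)
  · rw [firstSpan_of_le (by omega), firstSpan_of_le (by omega : n ≤ i)]
    omega

/-- The rank of the prefixes grows by at most one per row and ends above `k`, so it takes the value
`k` at some index not before `i`. -/
theorem le_lastRankIndex (hA : k < Module.finrank ℝ (rowspace A)) {i : ℕ}
    (h : Module.finrank ℝ (firstSpan A i) ≤ k) : i ≤ lastRankIndex k A := by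
  classical
  have hin : i ≤ n := by
    by_contra! hlt
    rw [firstSpan_of_le hlt.le] at h
    omega
  have hex : ∃ j, i ≤ j ∧ j ≤ n ∧ Module.finrank ℝ (firstSpan A j) = k := by
    by_contra! hne
    have : ∀ j, i ≤ j → j ≤ n → Module.finrank ℝ (firstSpan A j) < k := by
      intro j hij
      induction j, hij using Nat.le_induction with
      | base => intro hj; exact lt_of_le_of_ne h (hne i le_rfl hj)
      | succ j hij ih =>
        intro hj
        have h1 := ih (by omega)
        have h2 := finrank_firstSpan_succ_le (A := A) j
        exact lt_of_le_of_ne (by omega) (hne (j + 1) (by omega) hj)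
    have h1 := this n hin le_rfl
    rw [firstSpan_of_le le_rfl] at h1
    omega
  obtain ⟨j, hij, hjn, hj⟩ := hex
  refine hij.trans ?_
  rw [lastRankIndex]
  exact Nat.le_findGreatest hjn (by rw [rank_firstRows, hj])

theorem lt_finrank_firstSpan (hA : k < Module.finrank ℝ (rowspace A)) :
    k < Module.finrank ℝ (firstSpan A (lastRankIndex k A + 1)) := by
  by_contra! h
  have := le_lastRankIndex hA h
  omega

/-- The smallest nonzero singular value among the prefixes that enter `onlineCond`. -/
noncomputable def sigmaOnline (k : ℕ) (A : Matrix (Fin n) (Fin d) ℝ) : ℝ :=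
  sInf {s : ℝ | ∃ i : ℕ, i ≤ lastRankIndex k A + 1 ∧ firstRows A i ≠ 0 ∧
    s = sigmaMin (firstRows A i)}

theorem finite_sigmaMin :
    {s : ℝ | ∃ i : ℕ, i ≤ lastRankIndex k A + 1 ∧ firstRows A i ≠ 0 ∧
      s = sigmaMin (firstRows A i)}.Finite := by
  refine ((Set.finite_le_nat (lastRankIndex k A + 1)).image
    fun i => sigmaMin (firstRows A i)).subset ?_
  rintro _ ⟨i, hi, -, rfl⟩
  exact ⟨i, hi, rfl⟩

theorem sigmaOnline_pos {i : ℕ} (hi : i ≤ lastRankIndex k A + 1) (h0 : firstRows A i ≠ 0) :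
    0 < sigmaOnline k A := by
  have hne : {s : ℝ | ∃ i : ℕ, i ≤ lastRankIndex k A + 1 ∧ firstRows A i ≠ 0 ∧
    s = sigmaMin (firstRows A i)}.Nonempty := ⟨_, i, hi, h0, rfl⟩
  obtain ⟨j, -, hj, hs⟩ := hne.csInf_mem finite_sigmaMin
  rw [sigmaOnline, hs]
  exact sigmaMin_pos hj

theorem sigmaOnline_sq_mul_le {i : ℕ} (hi : i ≤ lastRankIndex k A + 1)
    {x : EuclideanSpace ℝ (Fin d)} (hx : x ∈ firstSpan A i) :
    sigmaOnline k A ^ 2 * ‖x‖ ^ 2 ≤ rowForm (row A) (firstIndices n i) x := by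
  rw [← rowspace_firstRows] at hx
  by_cases h0 : firstRows A i = 0
  · have h1 : x = 0 := by
      have h2 : rowspace (firstRows A i) = ⊥ := by
        rw [← Submodule.finrank_eq_zero (R := ℝ), finrank_rowspace, h0, Matrix.rank_zero]
      rwa [h2, Submodule.mem_bot] at hx
    rw [h1, norm_zero]
    simpa using rowForm_nonneg
  · rw [← rowForm_firstRows]
    refine le_trans ?_ (sigmaMin_sq_mul_le hx)
    refine mul_le_mul_of_nonneg_right (pow_le_pow_left₀ (sigmaOnline_pos hi h0).le ?_ 2)
      (sq_nonneg _)
    exact csInf_le finite_sigmaMin.bddBelow ⟨i, hi, h0, rfl⟩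

theorem sigmaOnline_le_opNorm {i : ℕ} (hi : i ≤ lastRankIndex k A + 1)
    (h0 : firstRows A i ≠ 0) : sigmaOnline k A ≤ opNorm A := by
  have h1 : firstSpan A i ≠ ⊥ := by
    intro h
    have := rank_pos_of_ne_zero h0
    rw [rank_firstRows, h, finrank_bot] at this
    omega
  obtain ⟨x, hx, hx0⟩ := (Submodule.ne_bot_iff _).mp h1
  have h2 := (sigmaOnline_sq_mul_le hi hx).trans
    ((rowForm_mono (Finset.subset_univ _)).trans (rowForm_le_opNorm_sq A x))
  have h3 : 0 < ‖x‖ ^ 2 := by positivity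
  exact (pow_le_pow_iff_left₀ (sigmaOnline_pos hi h0).le (norm_nonneg _) two_ne_zero).mp
    (le_of_mul_le_mul_right h2 h3)

theorem onlineCond_eq_zero_or_one_le : onlineCond k A = 0 ∨ 1 ≤ onlineCond k A := by
  by_cases h : ∃ i, i ≤ lastRankIndex k A + 1 ∧ firstRows A i ≠ 0
  · obtain ⟨i, hi, h0⟩ := h
    right
    exact (one_le_div (sigmaOnline_pos hi h0)).mpr (sigmaOnline_le_opNorm hi h0)
  · left
    have : {s : ℝ | ∃ i : ℕ, i ≤ lastRankIndex k A + 1 ∧ firstRows A i ≠ 0 ∧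
        s = sigmaMin (firstRows A i)} = ∅ := by
      ext s
      simp only [Set.mem_ofPred_eq, Set.mem_empty_iff_false, iff_false]
      rintro ⟨i, hi, h0, -⟩
      exact h ⟨i, hi, h0⟩
    -- With no prefix left, the infimum of the empty set is `0`, and division by `0` gives the value
    -- `0` for the condition number.
    rw [onlineCond, this, Real.sInf_empty, div_zero]

theorem log_mul_onlineCond_nonneg : 0 ≤ Real.log (n * onlineCond k A) := by
  rcases Nat.eq_zero_or_pos n with hn | hn
  · simp [hn]
  rcases onlineCond_eq_zero_or_one_le (k := k) (A := A) with h | h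
  · simp [h]
  · exact Real.log_nonneg (one_le_mul_of_one_le_of_one_le (by exact_mod_cast hn) h)

theorem firstRows_ne_zero (hA : k < Module.finrank ℝ (rowspace A)) :
    firstRows A (lastRankIndex k A + 1) ≠ 0 := by
  intro h
  have h1 := lt_finrank_firstSpan hA
  rw [← rank_firstRows, h, Matrix.rank_zero] at h1
  omega

theorem sigmaOnline_pos_of_lt (hA : k < Module.finrank ℝ (rowspace A)) :
    0 < sigmaOnline k A := sigmaOnline_pos le_rfl (firstRows_ne_zero hA)

theorem onlineCond_mul_sigmaOnline (hA : k < Module.finrank ℝ (rowspace A)) :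
    onlineCond k A * sigmaOnline k A = opNorm A :=
  div_mul_cancel₀ _ (sigmaOnline_pos_of_lt hA).ne'

theorem one_le_onlineCond (hA : k < Module.finrank ℝ (rowspace A)) : 1 ≤ onlineCond k A :=
  (one_le_div (sigmaOnline_pos_of_lt hA)).mpr (sigmaOnline_le_opNorm le_rfl (firstRows_ne_zero hA))

theorem norm_row_le_opNorm (t : Fin n) : ‖row A t‖ ≤ opNorm A := by
  have h1 : inner ℝ (row A t) (row A t) ^ 2 ≤ opNorm A ^ 2 * ‖row A t‖ ^ 2 :=
    (Finset.single_le_sum (f := fun i => inner ℝ (row A i) (row A t) ^ 2)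
      (fun i _ => sq_nonneg _) (Finset.mem_univ t)).trans (rowForm_le_opNorm_sq A _)
  rw [real_inner_self_eq_norm_sq] at h1
  have h0 : 0 ≤ opNorm A := norm_nonneg _
  rcases (norm_nonneg (row A t)).eq_or_lt with h | h
  · rwa [← h]
  · refine (pow_le_pow_iff_left₀ h.le h0 two_ne_zero).mp ?_
    refine le_of_mul_le_mul_right (le_trans (le_of_eq ?_) h1) (pow_pos h 2)
    ring

theorem finrank_rowspace_le : Module.finrank ℝ (rowspace A) ≤ n := by
  rw [finrank_rowspace]
  simpa using A.rank_le_height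

theorem sigmaOnline_sq_le_sum_distTo (hA : k < Module.finrank ℝ (rowspace A))
    {V : Submodule ℝ (EuclideanSpace ℝ (Fin d))} (hV : Module.finrank ℝ V ≤ k) :
    sigmaOnline k A ^ 2 ≤ ∑ i, distTo V (row A i) ^ 2 :=
  le_sum_distTo_of_rowForm (hV.trans_lt (lt_finrank_firstSpan hA)) fun _ hx =>
    (sigmaOnline_sq_mul_le le_rfl hx).trans (rowForm_mono (Finset.subset_univ _))

end OnlineCondition

/-! ### The size of the selected set -/

section Scaled

variable {n d k : ℕ} {A B : Matrix (Fin n) (Fin d) ℝ} {D : Fin n → ℝ}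

theorem span_row_image_scaled (hrow : ∀ i, row B i = D i • row A i) (hD : ∀ i, 1 ≤ D i)
    (U : Set (Fin n)) :
    Submodule.span ℝ (row B '' U) = Submodule.span ℝ (row A '' U) := by
  refine le_antisymm (Submodule.span_le.mpr ?_) (Submodule.span_le.mpr ?_)
  · rintro _ ⟨i, hi, rfl⟩
    rw [hrow]
    exact Submodule.smul_mem _ _ (Submodule.subset_span ⟨i, hi, rfl⟩)
  · rintro _ ⟨i, hi, rfl⟩
    have h : row A i = (D i)⁻¹ • row B i := by
      rw [hrow, smul_smul, inv_mul_cancel₀ (by linarith [hD i]), one_smul]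
    rw [h]
    exact Submodule.smul_mem _ _ (Submodule.subset_span ⟨i, hi, rfl⟩)

/-- This is where rounding the scaling factors up helps: factors of at least `1` preserve lower
bounds, so the singular values of the prefixes of the unscaled matrix control the scaled one. -/
theorem rowForm_le_rowForm_scaled (hrow : ∀ i, row B i = D i • row A i) (hD : ∀ i, 1 ≤ D i)
    (U : Finset (Fin n)) (x : EuclideanSpace ℝ (Fin d)) :
    rowForm (row A) U x ≤ rowForm (row B) U x := by
  refine Finset.sum_le_sum fun i _ => ?_
  rw [hrow, inner_smul_left, mul_pow]
  exact le_mul_of_one_le_left (sq_nonneg _) (by simpa using (hD i).trans (le_abs_self _))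

theorem lamAt_eq_zero_iff (hk : 1 ≤ k) (t : ℕ) :
    lamAt k B t = 0 ↔
      Module.finrank ℝ (Submodule.span ℝ (row B '' (before k B t : Set (Fin n)))) ≤ k := by
  have hk' : (k : ℝ) ≠ 0 := by positivity
  rw [lamAt, div_eq_zero_iff, or_iff_left hk', rankTailSq_eq_zero_iff]

theorem mem_before {t : ℕ} {i : Fin n} : i ∈ before k B t ↔ i ∈ coreset k B ∧ (i : ℕ) < t := by
  rw [before, Finset.mem_filter]

theorem span_before_of_lamAt_eq_zero {i : ℕ} (h0 : ∀ v < i, lamAt k B v = 0) :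
    Submodule.span ℝ (row B '' (before k B i : Set (Fin n))) =
      Submodule.span ℝ (row B '' (firstIndices n i : Set (Fin n))) := by
  refine le_antisymm (Submodule.span_mono (Set.image_mono fun u hu => ?_))
    (Submodule.span_le.mpr ?_)
  · simpa [firstIndices] using (mem_before.mp hu).2
  · rintro _ ⟨u, hu, rfl⟩
    have hui : (u : ℕ) < i := by simpa [firstIndices] using hu
    by_cases huS : u ∈ coreset k B
    · exact Submodule.subset_span ⟨u, mem_before.mpr ⟨huS, hui⟩, rfl⟩
    · rw [mem_coreset_iff] at huS
      push Not at huS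
      exact Submodule.span_mono (Set.image_mono (Finset.coe_subset.mpr (before_mono hui.le)))
        (huS.1 (h0 u hui))

/-- While `λ = 0`, each single row, selected or not, is dominated by the form of the selected rows.
Summing over at most `n` rows costs the factor `n`. -/
theorem rowForm_firstIndices_le {i : ℕ} (h0 : ∀ v < i, lamAt k B v = 0)
    (x : EuclideanSpace ℝ (Fin d)) :
    rowForm (row B) (firstIndices n i) x ≤ n * rowForm (row B) (before k B i) x := by
  have h : ∀ u ∈ firstIndices n i,
      inner ℝ (row B u) x ^ 2 ≤ rowForm (row B) (before k B i) x := by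
    intro u hu
    have hui : (u : ℕ) < i := by simpa [firstIndices] using hu
    by_cases huS : u ∈ coreset k B
    · exact Finset.single_le_sum (f := fun j => inner ℝ (row B j) x ^ 2)
        (fun j _ => sq_nonneg _) (mem_before.mpr ⟨huS, hui⟩)
    · have h1 := inner_sq_le_of_notMem_coreset huS x
      rw [h0 u hui, zero_mul, add_zero] at h1
      exact h1.trans (rowForm_mono (before_mono hui.le))
  refine (Finset.sum_le_card_nsmul _ _ _ h).trans ?_
  rw [nsmul_eq_mul]
  refine mul_le_mul_of_nonneg_right ?_ rowForm_nonneg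
  exact_mod_cast (Finset.card_le_univ _).trans_eq (Fintype.card_fin n)

/-- A lower bound for the nonzero values of the regularization parameter. -/
noncomputable def lamMin (k : ℕ) (A : Matrix (Fin n) (Fin d) ℝ) : ℝ :=
  sigmaOnline k A ^ 2 / n / k

variable (hk : 1 ≤ k) (hA : k < Module.finrank ℝ (rowspace A))
  (hrow : ∀ i, row B i = D i • row A i) (hD : ∀ i, 1 ≤ D i)

include hk hA in
theorem lamMin_pos : 0 < lamMin k A := by
  have h1 := sigmaOnline_pos_of_lt hA
  have h2 := finrank_rowspace_le (A := A)
  have hn : (0 : ℝ) < n := by exact_mod_cast (by omega : 0 < n)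
  have hk' : (0 : ℝ) < k := by exact_mod_cast hk
  rw [lamMin]
  positivity

include hk in
theorem lamMin_le : lamMin k A ≤ sigmaOnline k A ^ 2 / n := by
  have hk' : (1 : ℝ) ≤ k := by exact_mod_cast hk
  exact div_le_self (by positivity) hk'

include hA hrow hD in
theorem sigmaOnline_sq_div_mul_le {i : ℕ} (hi : i ≤ lastRankIndex k A + 1)
    (h0 : ∀ v < i, lamAt k B v = 0) {x : EuclideanSpace ℝ (Fin d)} (hx : x ∈ firstSpan A i) :
    sigmaOnline k A ^ 2 / n * ‖x‖ ^ 2 ≤ rowForm (row B) (before k B i) x := by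
  have h2 := finrank_rowspace_le (A := A)
  have hn : (0 : ℝ) < n := by exact_mod_cast (by omega : 0 < n)
  rw [div_mul_eq_mul_div, div_le_iff₀ hn, mul_comm _ (n : ℝ)]
  exact (sigmaOnline_sq_mul_le hi hx).trans
    ((rowForm_le_rowForm_scaled hrow hD _ _).trans (rowForm_firstIndices_le h0 x))

include hk hA hrow hD in
theorem le_lastRankIndex_of_lamAt {t : ℕ} (h0 : lamAt k B t = 0) : t ≤ lastRankIndex k A := by
  refine le_lastRankIndex hA ?_
  have hz : ∀ v < t, lamAt k B v = 0 := fun v hv =>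
    le_antisymm ((lamAt_mono hv.le).trans h0.le) (lamAt_nonneg v)
  rw [lamAt_eq_zero_iff hk, span_before_of_lamAt_eq_zero hz,
    span_row_image_scaled hrow hD] at h0
  exact h0

include hk hA hrow hD in
-- By monotonicity only the first nonzero `λ` matters. At that moment the selected rows still span
-- the whole prefix, which has rank above `k`, and their form is at least `σ² / n` on this span;
-- Courant–Fischer bounds the rank-`k` error by the same quantity.
theorem lamAt_eq_zero_or_le (t : ℕ) : lamAt k B t = 0 ∨ lamMin k A ≤ lamAt k B t := by
  classical
  by_contra! h
  have hex : ∃ m, lamAt k B m ≠ 0 := ⟨t, h.1⟩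
  set m := Nat.find hex with hm
  have hmne : lamAt k B m ≠ 0 := Nat.find_spec hex
  have hz : ∀ v < m, lamAt k B v = 0 := fun v hv => by
    have := Nat.find_min hex hv
    push Not at this
    exact this
  have hm0 : m ≠ 0 := by
    intro h0
    refine hmne ((lamAt_eq_zero_iff hk m).mpr ?_)
    have : before k B m = ∅ := by
      ext i
      simp [mem_before, h0]
    rw [this, Finset.coe_empty, Set.image_empty, Submodule.span_empty, finrank_bot]
    exact Nat.zero_le k
  -- The prefix of length `m - 1` still has rank at most `k`. This is why the minimum in the
  -- condition number has to reach one row beyond the last index of rank `k`.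
  have hmi : m ≤ lastRankIndex k A + 1 := by
    have := le_lastRankIndex_of_lamAt hk hA hrow hD (hz (m - 1) (by omega))
    omega
  have hspan : Submodule.span ℝ (row B '' (before k B m : Set (Fin n))) = firstSpan A m := by
    rw [span_before_of_lamAt_eq_zero hz, span_row_image_scaled hrow hD]
    rfl
  have hrank : k < Module.finrank ℝ (firstSpan A m) := by
    rw [Ne, lamAt_eq_zero_iff hk, hspan] at hmne
    omega
  have h1 : sigmaOnline k A ^ 2 / n ≤ rankTailSq k (restrictRows B (before k B m)) :=
    le_rankTailSq hrank fun x hx => sigmaOnline_sq_div_mul_le hA hrow hD hmi hz hx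
  have h2 : lamMin k A ≤ lamAt k B m := div_le_div_of_nonneg_right h1 (Nat.cast_nonneg k)
  have h3 : m ≤ t := Nat.find_min' hex h.1
  exact absurd (h2.trans (lamAt_mono h3)) (not_le.mpr h.2)

include hk hA hrow hD in
-- Replacing `λ` by at least `lamMin` makes the potential argument uniform, including the phase `λ =
-- 0`. The constant `4` is twice the `2` from the selection threshold, since in that phase the term
-- `lamMin * ‖x‖²` is paid for by the form itself.
theorem exists_le_inner_sq_of_mem_coreset {t : Fin n} (ht : t ∈ coreset k B) :
    ∃ x : EuclideanSpace ℝ (Fin d), inner ℝ (row B t) x ≠ 0 ∧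
      max (lamAt k B t) (lamMin k A) * ‖x‖ ^ 2 + rowForm (row B) (before k B t) x ≤
        4 * inner ℝ (row B t) x ^ 2 := by
  have hmin := lamMin_pos hk hA
  rcases lamAt_eq_zero_or_le hk hA hrow hD (B := B) t with h0 | h0
  · rw [h0, max_eq_right hmin.le]
    have hti := le_lastRankIndex_of_lamAt hk hA hrow hD h0
    have hz : ∀ v < (t : ℕ), lamAt k B v = 0 := fun v hv =>
      le_antisymm ((lamAt_mono hv.le).trans h0.le) (lamAt_nonneg v)
    have hspan : Submodule.span ℝ (row B '' (before k B t : Set (Fin n))) = firstSpan A t := by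
      rw [span_before_of_lamAt_eq_zero hz, span_row_image_scaled hrow hD]
      rfl
    set W := firstSpan A t with hW
    -- A row in the span of its predecessors was selected for its score. Projecting its test vector
    -- to `W` changes neither the form nor the inner product, and on `W` the form dominates `lamMin
    -- * ‖x‖²`.
    by_cases hb : row B t ∈ W
    · rcases exists_of_mem_coreset hk ht with h | ⟨x, hx0, hx⟩
      · rw [hspan] at h
        exact absurd hb h.2
      · have h1 : inner ℝ (row B t) (W.starProjection x) = inner ℝ (row B t) x := by
          rw [← Submodule.inner_starProjection_left_eq_right,
            Submodule.starProjection_eq_self_iff.mpr hb]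
        have h2 : rowForm (row B) (before k B t) (W.starProjection x) =
            rowForm (row B) (before k B t) x :=
          rowForm_starProjection_span fun i hi =>
            hspan ▸ Submodule.subset_span (Set.mem_image_of_mem _ hi)
        have h3 := sigmaOnline_sq_div_mul_le hA hrow hD (hti.trans (Nat.le_succ _)) hz
          (W.starProjection_apply_mem x)
        have h4 := mul_le_mul_of_nonneg_right (lamMin_le (A := A) hk)
          (sq_nonneg ‖W.starProjection x‖)
        rw [h0, zero_mul, add_zero] at hx
        refine ⟨W.starProjection x, by rwa [h1], ?_⟩
        rw [h1]
        rw [h2] at h3 ⊢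
        linarith
    -- A row outside the span is tested with its new direction. There the earlier rows vanish, and
    -- the prefix ending with this row has its smallest singular value at least `sigmaOnline`.
    · set x := row B t - W.starProjection (row B t) with hx
      have hxW : x ∈ Wᗮ := sub_starProjection_mem
      have hinner : inner ℝ (row B t) x = ‖x‖ ^ 2 := inner_self_sub_starProjection
      have hx0 : x ≠ 0 := fun h => hb (distTo_eq_zero_iff.mp (norm_eq_zero.mpr h))
      have hzero : ∀ U : Finset (Fin n), (∀ i ∈ U, row B i ∈ W) → rowForm (row B) U x = 0 :=
        fun U hU => Finset.sum_eq_zero fun i hi => by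
          rw [Submodule.inner_right_of_mem_orthogonal (hU i hi) hxW]
          norm_num
      have h1 : rowForm (row B) (before k B t) x = 0 := hzero _ fun i hi =>
        hspan ▸ Submodule.subset_span (Set.mem_image_of_mem _ hi)
      have hfirst : firstIndices n (t + 1) = insert t (firstIndices n t) := by
        ext j
        simp only [firstIndices, Finset.mem_filter, Finset.mem_univ, true_and, Finset.mem_insert,
          Fin.ext_iff]
        omega
      have hxspan : x ∈ firstSpan A (t + 1) := by
        refine Submodule.sub_mem _ ?_
          (firstSpan_mono (Nat.le_succ _) (W.starProjection_apply_mem _))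
        rw [hrow]
        refine Submodule.smul_mem _ _ (Submodule.subset_span ⟨t, ?_, rfl⟩)
        rw [hfirst]
        exact Finset.mem_insert_self _ _
      have h2 : sigmaOnline k A ^ 2 * ‖x‖ ^ 2 ≤ inner ℝ (row B t) x ^ 2 := by
        refine (sigmaOnline_sq_mul_le (Nat.succ_le_succ hti) hxspan).trans
          ((rowForm_le_rowForm_scaled hrow hD _ _).trans_eq ?_)
        rw [hfirst, rowForm, Finset.sum_insert (by simp [firstIndices])]
        have : rowForm (row B) (firstIndices n t) x = 0 := hzero _ fun i hi => by
          rw [hrow]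
          exact Submodule.smul_mem _ _ (Submodule.subset_span (Set.mem_image_of_mem _ hi))
        rw [rowForm] at this
        rw [this, add_zero]
      have hn : (1 : ℝ) ≤ n := by
        exact_mod_cast (by have := t.2; omega : 1 ≤ n)
      have h3 : lamMin k A ≤ sigmaOnline k A ^ 2 :=
        (lamMin_le hk).trans (div_le_self (sq_nonneg _) hn)
      have h4 := mul_le_mul_of_nonneg_right h3 (sq_nonneg ‖x‖)
      refine ⟨x, by rw [hinner]; positivity, ?_⟩
      rw [h1]
      linarith [sq_nonneg (inner ℝ (row B t) x)]
  · rw [max_eq_left h0]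
    rcases exists_of_mem_coreset hk ht with h | ⟨x, hx0, hx⟩
    · linarith [h.1]
    · exact ⟨x, hx0, by linarith [sq_nonneg (inner ℝ (row B t) x)]⟩

include hk hA hrow hD in
open Classical in
-- The lower and upper bounds for the determinant at regularization `μ` are compared; the common
-- factor `μ ^ d` cancels, so no dependence on `d` remains.
theorem card_filter_coreset_le {F μ : ℝ} (hF : ∑ i, ‖row B i‖ ^ 2 ≤ F) (hμ : lamMin k A ≤ μ) :
    (((coreset k B).filter fun t : Fin n => μ ≤ max (lamAt k B t) (lamMin k A) ∧
        max (lamAt k B t) (lamMin k A) < 2 * μ).card : ℝ) ≤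
      1 + 5 * k * (6 + Real.log (1 + 2 * F / lamMin k A)) := by
  have hmin := lamMin_pos hk hA
  have hμ0 : 0 < μ := hmin.trans_le hμ
  have hF0 : 0 ≤ F := (Finset.sum_nonneg fun i _ => sq_nonneg _).trans hF
  have hone : 1 ≤ 1 + 2 * F / lamMin k A := le_add_of_nonneg_right (by positivity)
  have hlog : 0 ≤ Real.log (1 + 2 * F / lamMin k A) := Real.log_nonneg hone
  have hk0 : (0 : ℝ) < k := by exact_mod_cast hk
  set Q : Fin n → Prop := fun t => μ ≤ max (lamAt k B t) (lamMin k A) ∧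
    max (lamAt k B t) (lamMin k A) < 2 * μ with hQ
  set E := (coreset k B).filter Q with hE
  rcases E.eq_empty_or_nonempty with hemp | hne
  · rw [hemp, Finset.card_empty, Nat.cast_zero]
    positivity
  -- The determinant is taken just before the last row `m` of the window. There `λ < 2μ` still
  -- holds, so the rank-`k` error is at most `2kμ`; the slack `kμ` in the choice of `V` makes it
  -- `3kμ`. The row `m` itself accounts for the summand `1`.
  set m := E.max' hne with hm
  have hmE : m ∈ E := E.max'_mem hne
  have hmQ : Q m := (Finset.mem_filter.mp hmE).2
  set U := before k B m with hU
  have hcard : E.card ≤ (U.filter Q).card + 1 := by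
    have hsub : E ⊆ insert m (U.filter Q) := by
      intro t ht
      rw [Finset.mem_insert]
      by_cases htm : t = m
      · exact Or.inl htm
      · refine Or.inr (Finset.mem_filter.mpr ⟨mem_before.mpr ⟨(Finset.mem_filter.mp ht).1, ?_⟩,
          (Finset.mem_filter.mp ht).2⟩)
        exact lt_of_le_of_ne (α := Fin n) (E.le_max' t ht) htm
    exact (Finset.card_le_card hsub).trans (Finset.card_insert_le _ _)
  have hlow : μ ^ d * (5 / 4 : ℝ) ^ (U.filter Q).card ≤ (ridgeGram μ (row B) U).det := by
    refine pow_mul_le_det_ridgeGram hμ0 Q fun t ht htQ => ?_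
    have htS := mem_before.mp ht
    obtain ⟨x, hx0, hx⟩ := exists_le_inner_sq_of_mem_coreset hk hA hrow hD htS.1
    refine ⟨x, hx0, le_trans (add_le_add ?_ (rowForm_mono ?_)) hx⟩
    · exact mul_le_mul_of_nonneg_right htQ.1 (sq_nonneg _)
    · intro i hi
      rw [Finset.mem_filter] at hi
      exact mem_before.mpr ⟨(mem_before.mp hi.1).1, hi.2⟩
  obtain ⟨V, hV, hVlt⟩ := exists_sum_distTo_lt (k := k) B U (mul_pos hk0 hμ0)
  have htail : rankTailSq k (restrictRows B U) ≤ k * (2 * μ) := by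
    have h1 : lamAt k B m ≤ 2 * μ := (le_max_left _ _).trans hmQ.2.le
    rwa [lamAt, div_le_iff₀' hk0] at h1
  have hup := det_ridgeGram_le (b := row B) (U := U) hμ0 (k := k) (F := F) (τ := 3 * k * μ)
    ((Finset.sum_le_sum_of_subset_of_nonneg (Finset.subset_univ _) fun _ _ _ => sq_nonneg _).trans
      hF) hV (by linarith)
  have hpow : (5 / 4 : ℝ) ^ (U.filter Q).card ≤
      (1 + 2 * F / lamMin k A) ^ k * Real.exp (6 * k) := by
    refine (le_of_mul_le_mul_left (hlow.trans hup) (pow_pos hμ0 d)).trans ?_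
    have h1 : 2 * (3 * k * μ) / μ = 6 * k := by field_simp; ring
    rw [h1]
    gcongr
  have h2 := Real.log_le_log (by positivity) hpow
  rw [Real.log_pow, Real.log_mul (by positivity) (Real.exp_ne_zero _), Real.log_pow,
    Real.log_exp] at h2
  have h3 : (1 / 5 : ℝ) ≤ Real.log (5 / 4) := by
    have := Real.one_sub_inv_le_log_of_pos (show (0 : ℝ) < 5 / 4 by norm_num)
    norm_num at this ⊢
    exact this
  have h4 : ((U.filter Q).card : ℝ) * (1 / 5) ≤ (U.filter Q).card * Real.log (5 / 4) :=
    mul_le_mul_of_nonneg_left h3 (Nat.cast_nonneg _)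
  have h5 : (E.card : ℝ) ≤ (U.filter Q).card + 1 := by exact_mod_cast hcard
  nlinarith

include hk hA hrow hD in
-- The values of `max λ lamMin` lie between `lamMin` and `lamMin + F`, so logarithmically many
-- dyadic windows cover them.
theorem card_coreset_le {F : ℝ} (hF : ∑ i, ‖row B i‖ ^ 2 ≤ F) :
    ((coreset k B).card : ℝ) ≤
      (2 * Real.log (1 + 2 * F / lamMin k A) + 1) *
        (1 + 5 * k * (6 + Real.log (1 + 2 * F / lamMin k A))) := by
  classical
  have hmin := lamMin_pos hk hA
  have hF0 : 0 ≤ F := (Finset.sum_nonneg fun i _ => sq_nonneg _).trans hF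
  have hFm : 0 ≤ F / lamMin k A := by positivity
  have h2F : 2 * F / lamMin k A = 2 * (F / lamMin k A) := mul_div_assoc _ _ _
  have hlog : 0 ≤ Real.log (1 + 2 * F / lamMin k A) :=
    Real.log_nonneg (le_add_of_nonneg_right (by positivity))
  set J := Nat.log 2 ⌊1 + F / lamMin k A⌋₊ with hJ
  have hlam : ∀ t : Fin n, max (lamAt k B t) (lamMin k A) / lamMin k A ≤ 1 + F / lamMin k A := by
    intro t
    have h1 : lamAt k B t ≤ F := by
      refine (div_le_self (rankTailSq_nonneg _) (by exact_mod_cast hk)).trans ?_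
      refine (rankTailSq_le_sum_distTo B _ (V := ⊥) (by simp)).trans (le_trans ?_ hF)
      refine (Finset.sum_le_sum_of_subset_of_nonneg (Finset.subset_univ _)
        fun _ _ _ => sq_nonneg _).trans (Finset.sum_le_sum fun i _ => ?_)
      exact pow_le_pow_left₀ distTo_nonneg distTo_le_norm 2
    rw [div_le_iff₀ hmin, add_mul, one_mul, div_mul_cancel₀ _ hmin.ne']
    exact max_le (by linarith) (by linarith)
  have hcover : coreset k B ⊆ (Finset.range (J + 1)).biUnion fun j =>
      (coreset k B).filter fun t : Fin n => 2 ^ j * lamMin k A ≤ max (lamAt k B t) (lamMin k A) ∧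
        max (lamAt k B t) (lamMin k A) < 2 * (2 ^ j * lamMin k A) := by
    intro t ht
    set r := max (lamAt k B t) (lamMin k A) / lamMin k A with hr
    have hr1 : 1 ≤ r := (one_le_div hmin).mpr (le_max_right _ _)
    have hr0 : ⌊r⌋₊ ≠ 0 := (Nat.floor_pos.mpr hr1).ne'
    have hmaxr : max (lamAt k B t) (lamMin k A) = r * lamMin k A :=
      (div_mul_cancel₀ _ hmin.ne').symm
    rw [Finset.mem_biUnion]
    refine ⟨Nat.log 2 ⌊r⌋₊, ?_, Finset.mem_filter.mpr ⟨ht, ?_, ?_⟩⟩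
    · rw [Finset.mem_range, Nat.lt_succ_iff]
      exact Nat.log_mono_right (Nat.floor_mono (hlam t))
    · rw [hmaxr]
      refine mul_le_mul_of_nonneg_right ?_ hmin.le
      have h1 : 2 ^ Nat.log 2 ⌊r⌋₊ ≤ ⌊r⌋₊ := Nat.pow_log_le_self 2 hr0
      calc (2 : ℝ) ^ Nat.log 2 ⌊r⌋₊ ≤ (⌊r⌋₊ : ℝ) := by exact_mod_cast h1
        _ ≤ r := Nat.floor_le (by linarith)
    · rw [hmaxr, ← mul_assoc]
      refine mul_lt_mul_of_pos_right ?_ hmin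
      have h1 : ⌊r⌋₊ + 1 ≤ 2 ^ (Nat.log 2 ⌊r⌋₊ + 1) := Nat.lt_pow_succ_log_self (by norm_num) _
      calc r < (⌊r⌋₊ : ℝ) + 1 := Nat.lt_floor_add_one r
        _ ≤ 2 ^ (Nat.log 2 ⌊r⌋₊ + 1) := by exact_mod_cast h1
        _ = 2 * 2 ^ Nat.log 2 ⌊r⌋₊ := pow_succ' _ _
  have hcard : ((coreset k B).card : ℝ) ≤
      ∑ j ∈ Finset.range (J + 1), (1 + 5 * k * (6 + Real.log (1 + 2 * F / lamMin k A))) := by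
    have h1 := (Finset.card_le_card hcover).trans Finset.card_biUnion_le
    refine (Nat.cast_le.mpr h1).trans ?_
    rw [Nat.cast_sum]
    refine Finset.sum_le_sum fun j _ => card_filter_coreset_le hk hA hrow hD hF ?_
    exact le_mul_of_one_le_left hmin.le (one_le_pow₀ (by norm_num))
  rw [Finset.sum_const, Finset.card_range, nsmul_eq_mul] at hcard
  refine hcard.trans (mul_le_mul_of_nonneg_right ?_ (by positivity))
  have h1 : ⌊1 + F / lamMin k A⌋₊ ≠ 0 := (Nat.floor_pos.mpr (by linarith)).ne'
  have h2 : (2 : ℝ) ^ J ≤ 1 + 2 * F / lamMin k A := by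
    have h3 : 2 ^ J ≤ ⌊1 + F / lamMin k A⌋₊ := Nat.pow_log_le_self 2 h1
    calc (2 : ℝ) ^ J ≤ (⌊1 + F / lamMin k A⌋₊ : ℝ) := by exact_mod_cast h3
      _ ≤ 1 + F / lamMin k A := Nat.floor_le (by linarith)
      _ ≤ _ := by linarith
  have h3 := Real.log_le_log (by positivity) h2
  rw [Real.log_pow] at h3
  have h4 : (1 / 2 : ℝ) ≤ Real.log 2 := by linarith [Real.log_two_gt_d9]
  have h5 : (J : ℝ) * (1 / 2) ≤ J * Real.log 2 := mul_le_mul_of_nonneg_left h4 (Nat.cast_nonneg _)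
  push_cast
  linarith

end Scaled

/-! ### Distances of all rows from the distances of the selected rows -/

section Domination

variable {n d k : ℕ} {A B : Matrix (Fin n) (Fin d) ℝ}
  {V : Submodule ℝ (EuclideanSpace ℝ (Fin d))}

theorem linfCost_nonneg {ι : Type*} (C : Matrix ι (Fin d) ℝ) : 0 ≤ linfCost C V :=
  Real.iSup_nonneg fun _ => distTo_nonneg

theorem distTo_le_linfCost {ι : Type*} [Finite ι] (C : Matrix ι (Fin d) ℝ) (i : ι) :
    distTo V (row C i) ≤ linfCost C V :=
  le_ciSup (f := fun i => distTo V (row C i)) (Set.finite_range _).bddAbove i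

theorem distTo_le_linfCost_restrictRows {S : Finset (Fin n)} {i : Fin n} (hi : i ∈ S) :
    distTo V (row B i) ≤ linfCost (restrictRows B S) V :=
  distTo_le_linfCost (restrictRows B S) ⟨i, hi⟩

theorem linfCost_restrictRows_le {S : Finset (Fin n)} {c : ℝ} (hc : 0 ≤ c)
    (h : ∀ i ∈ S, distTo V (row B i) ≤ c) : linfCost (restrictRows B S) V ≤ c :=
  Real.iSup_le (fun i => h i i.2) hc

theorem sum_distTo_sq_le {S U : Finset (Fin n)} (hU : U ⊆ S) :
    ∑ i ∈ U, distTo V (row B i) ^ 2 ≤ S.card * linfCost (restrictRows B S) V ^ 2 := by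
  refine (Finset.sum_le_sum_of_subset_of_nonneg hU fun _ _ _ => sq_nonneg _).trans ?_
  refine (Finset.sum_le_card_nsmul _ _ _ fun i hi => ?_).trans_eq (nsmul_eq_mul _ _)
  exact pow_le_pow_left₀ distTo_nonneg (distTo_le_linfCost_restrictRows hi) 2

theorem lamAt_le (hk : 1 ≤ k) (hV : Module.finrank ℝ V ≤ k) (t : ℕ) :
    lamAt k B t ≤ (coreset k B).card * linfCost (restrictRows B (coreset k B)) V ^ 2 :=
  (div_le_self (rankTailSq_nonneg _) (by exact_mod_cast hk)).trans
    ((rankTailSq_le_sum_distTo B _ hV).trans (sum_distTo_sq_le (before_subset t)))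

/-- The ridge inequality is tested with the component `x` of the row orthogonal to `W`. Its left
side is `d⁴` and its right side is a multiple of `‖x‖² = d²`, with `d` the distance of the row. -/
theorem distTo_sq_le_of_notMem_coreset {W : Submodule ℝ (EuclideanSpace ℝ (Fin d))} {t : Fin n}
    (ht : t ∉ coreset k B) :
    distTo W (row B t) ^ 2 ≤
      ∑ i ∈ before k B t, distTo W (row B i) ^ 2 + lamAt k B t := by
  set x := row B t - W.starProjection (row B t) with hx
  have h1 := inner_sq_le_of_notMem_coreset ht x
  rw [inner_self_sub_starProjection] at h1
  have h2 := rowForm_le_sum_distTo (b := row B) (U := before k B t)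
    (show x ∈ Wᗮ from sub_starProjection_mem)
  have h3 : ‖x‖ = distTo W (row B t) := rfl
  rw [h3] at h1 h2
  have h4 : distTo W (row B t) ^ 2 * distTo W (row B t) ^ 2 ≤
      (∑ i ∈ before k B t, distTo W (row B i) ^ 2 + lamAt k B t) * distTo W (row B t) ^ 2 := by
    nlinarith
  rcases (sq_nonneg (distTo W (row B t))).eq_or_lt with h0 | h0
  · rw [← h0]
    exact add_nonneg (Finset.sum_nonneg fun _ _ => sq_nonneg _) (lamAt_nonneg _)
  · exact le_of_mul_le_mul_right h4 h0

theorem distTo_sq_le_linfCost (hk : 1 ≤ k) (hV : Module.finrank ℝ V ≤ k) (t : Fin n) :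
    distTo V (row B t) ^ 2 ≤
      2 * (coreset k B).card * linfCost (restrictRows B (coreset k B)) V ^ 2 := by
  by_cases ht : t ∈ coreset k B
  · have h1 : distTo V (row B t) ^ 2 ≤ linfCost (restrictRows B (coreset k B)) V ^ 2 :=
      pow_le_pow_left₀ distTo_nonneg (distTo_le_linfCost_restrictRows ht) 2
    have h2 : (1 : ℝ) ≤ (coreset k B).card := by
      exact_mod_cast Finset.card_pos.mpr ⟨t, ht⟩
    refine h1.trans (le_mul_of_one_le_left (sq_nonneg _) (by linarith))
  · have h1 := distTo_sq_le_of_notMem_coreset (W := V) ht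
    have h2 := lamAt_le (B := B) hk hV t
    have h3 := sum_distTo_sq_le (B := B) (V := V) (before_subset (k := k) (B := B) t)
    linarith

/-- For `W` the span of the selection, the sum over selected rows vanishes and only `λ` remains. It
is bounded by the cost of an arbitrary `V` of dimension at most `k`. -/
theorem distTo_span_coreset_sq_le (hk : 1 ≤ k) (hV : Module.finrank ℝ V ≤ k) (t : Fin n) :
    distTo (Submodule.span ℝ (row B '' (coreset k B : Set (Fin n)))) (row B t) ^ 2 ≤
      2 * (coreset k B).card * linfCost (restrictRows B (coreset k B)) V ^ 2 := by
  set W := Submodule.span ℝ (row B '' (coreset k B : Set (Fin n))) with hW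
  have hmem : ∀ i ∈ coreset k B, distTo W (row B i) = 0 := fun i hi =>
    distTo_eq_zero_iff.mpr (Submodule.subset_span (Set.mem_image_of_mem _ hi))
  by_cases ht : t ∈ coreset k B
  · rw [hmem t ht, zero_pow two_ne_zero]
    positivity
  · have h1 := distTo_sq_le_of_notMem_coreset (W := W) ht
    rw [Finset.sum_eq_zero fun i hi => by rw [hmem i (before_subset _ hi)]; norm_num,
      zero_add] at h1
    have h2 := lamAt_le (B := B) hk hV t
    have h3 : 0 ≤ (coreset k B).card * linfCost (restrictRows B (coreset k B)) V ^ 2 := by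
      positivity
    linarith

theorem span_coreset_of_finrank_le (hk : 1 ≤ k) (hB : Module.finrank ℝ (rowspace B) ≤ k) :
    Submodule.span ℝ (row B '' (coreset k B : Set (Fin n))) = rowspace B := by
  have h0 : ∀ v < n, lamAt k B v = 0 := fun v _ => by
    rw [lamAt_eq_zero_iff hk]
    refine (Submodule.finrank_mono ?_).trans hB
    exact Submodule.span_mono (Set.image_subset_range _ _)
  have h1 := span_before_of_lamAt_eq_zero h0
  rw [before_top] at h1
  rw [h1]
  exact firstSpan_of_le le_rfl

end Domination

/-! ### Exponential random variables -/

section Exponential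

theorem expMeasure_Iic {c : ℝ} (hc : 0 ≤ c) :
    (expMeasure 1).real (Set.Iic c) = 1 - Real.exp (-c) := by
  have := isProbabilityMeasure_expMeasure (r := 1) one_pos
  rw [← cdf_eq_real, cdf_expMeasure_eq one_pos, if_pos hc, one_mul]

theorem expMeasure_Ioi {c : ℝ} (hc : 0 ≤ c) :
    (expMeasure 1).real (Set.Ioi c) = Real.exp (-c) := by
  have := isProbabilityMeasure_expMeasure (r := 1) one_pos
  rw [← Set.compl_Iic, probReal_compl_eq_one_sub measurableSet_Iic, expMeasure_Iic hc]
  ring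

variable {Ω : Type*} [MeasurableSpace Ω] {μ : Measure Ω} [IsProbabilityMeasure μ] {n : ℕ}
  {e : Fin n → Ω → ℝ}

omit [IsProbabilityMeasure μ] in
theorem measureReal_exists_le (he : ∀ i, HasLaw (e i) (expMeasure 1) μ) {c : Fin n → ℝ}
    (hc : ∀ i, 0 ≤ c i) : μ.real {ω | ∃ i, e i ω ≤ c i} ≤ ∑ i, c i := by
  have h : {ω | ∃ i, e i ω ≤ c i} = ⋃ i, {ω | e i ω ≤ c i} := by
    ext ω; simp
  rw [h]
  refine (measureReal_iUnion_fintype_le _).trans (Finset.sum_le_sum fun i _ => ?_)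
  rw [(he i).measureReal_eq (p := fun x => x ≤ c i) measurableSet_Iic]
  change (expMeasure 1).real (Set.Iic (c i)) ≤ c i
  rw [expMeasure_Iic (hc i)]
  linarith [Real.add_one_le_exp (-c i)]

omit [IsProbabilityMeasure μ] in
theorem measureReal_forall_lt (he : ∀ i, HasLaw (e i) (expMeasure 1) μ) (hind : iIndepFun e μ)
    {c : Fin n → ℝ} (hc : ∀ i, 0 ≤ c i) :
    μ.real {ω | ∀ i, c i < e i ω} = Real.exp (-∑ i, c i) := by
  have h : {ω | ∀ i, c i < e i ω} = ⋂ i ∈ Finset.univ, e i ⁻¹' Set.Ioi (c i) := by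
    ext ω; simp
  rw [h, measureReal_def, hind.measure_inter_preimage_eq_mul Finset.univ
    (fun i _ => measurableSet_Ioi), ENNReal.toReal_prod, ← Finset.sum_neg_distrib, Real.exp_sum]
  refine Finset.prod_congr rfl fun i _ => ?_
  rw [← expMeasure_Ioi (hc i)]
  exact (he i).measureReal_eq (p := fun x => c i < x) measurableSet_Ioi

omit [IsProbabilityMeasure μ] in
-- The minimum of the `e i / c i` is exponential of rate `∑ c j`. In the division-free form the
-- event is empty when all weights vanish, which needs an index to exist.
theorem measureReal_forall_lt_le (he : ∀ i, HasLaw (e i) (expMeasure 1) μ)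
    (hind : iIndepFun e μ) (hn : 0 < n) {c : Fin n → ℝ} (hc : ∀ i, 0 ≤ c i) {R : ℝ}
    (hR : 0 ≤ R) :
    μ.real {ω | ∀ i, R * c i < e i ω * ∑ j, c j} ≤ Real.exp (-R) := by
  rcases (Finset.sum_nonneg fun j (_ : j ∈ Finset.univ) => hc j).eq_or_lt with h0 | h0
  · have : {ω | ∀ i, R * c i < e i ω * ∑ j, c j} = ∅ := by
      ext ω
      simp only [Set.mem_ofPred_eq, Set.mem_empty_iff_false, iff_false, not_forall, not_lt]
      refine ⟨⟨0, hn⟩, ?_⟩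
      rw [← h0, mul_zero]
      exact mul_nonneg hR (hc _)
    rw [this, measureReal_empty]
    exact (Real.exp_pos _).le
  · have : {ω | ∀ i, R * c i < e i ω * ∑ j, c j} = {ω | ∀ i, R * c i / ∑ j, c j < e i ω} := by
      ext ω
      simp only [Set.mem_ofPred_eq, div_lt_iff₀ h0]
    rw [this, measureReal_forall_lt he hind fun i => div_nonneg (mul_nonneg hR (hc i)) h0.le,
      ← Finset.sum_div, ← Finset.mul_sum, mul_div_cancel_right₀ _ h0.ne']

/-- Subadditivity of the outer measure over `good` and three bad events of measure at most `1/100`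
each; therefore `good` need not be measurable. -/
theorem nine_tenths_le_measure (he : ∀ i, HasLaw (e i) (expMeasure 1) μ) (hind : iIndepFun e μ)
    (hn : 0 < n) {c₁ c₂ : Fin n → ℝ} (hc₁ : ∀ i, 0 ≤ c₁ i) (hc₂ : ∀ i, 0 ≤ c₂ i)
    (hs₁ : ∑ i, c₁ i ≤ 1 / 100) (hs₂ : ∑ i, c₂ i ≤ 1 / 100) {κ : Type*} (G : Finset κ)
    (w : κ → Fin n → ℝ) (hw : ∀ g i, 0 ≤ w g i) {R : ℝ} (hR : 0 ≤ R)
    (hG : G.card * Real.exp (-R) ≤ 1 / 100) {good : Set Ω}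
    (hgood : ∀ ω, (∀ i, c₁ i < e i ω) → (∀ i, c₂ i < e i ω) →
      (∀ g ∈ G, ∃ i, e i ω * ∑ j, w g j ≤ R * w g i) → ω ∈ good) :
    9 / 10 ≤ μ good := by
  set bad : Set Ω := ⋃ g ∈ G, {ω | ∀ i, R * w g i < e i ω * ∑ j, w g j} with hbad
  have hcover : (Set.univ : Set Ω) ⊆
      good ∪ ({ω | ∃ i, e i ω ≤ c₁ i} ∪ ({ω | ∃ i, e i ω ≤ c₂ i} ∪ bad)) := by
    intro ω _
    by_contra h
    simp only [Set.mem_union, not_or, Set.mem_ofPred_eq, not_exists, not_le, hbad,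
      Set.mem_iUnion, not_forall, not_lt] at h
    refine h.1 (hgood ω h.2.1 h.2.2.1 fun g hg => ?_)
    obtain ⟨i, hi⟩ := h.2.2.2 g hg
    exact ⟨i, hi⟩
  have hb : μ.real bad ≤ 1 / 100 := by
    refine (measureReal_biUnion_finset_le _ _).trans (le_trans ?_ hG)
    refine (Finset.sum_le_card_nsmul _ _ _ fun g _ => ?_).trans_eq (nsmul_eq_mul _ _)
    exact measureReal_forall_lt_le he hind hn (hw g) hR
  have h1 : 1 ≤ μ.real good + (1 / 100 + (1 / 100 + 1 / 100)) := by
    calc (1 : ℝ) = μ.real Set.univ := probReal_univ.symm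
      _ ≤ _ := measureReal_mono hcover
      _ ≤ _ := (measureReal_union_le _ _).trans (add_le_add le_rfl ((measureReal_union_le _ _).trans
        (add_le_add ((measureReal_exists_le he hc₁).trans hs₁) ((measureReal_union_le _ _).trans
          (add_le_add ((measureReal_exists_le he hc₂).trans hs₂) hb)))))
  have h2 : (9 / 10 : ℝ) ≤ μ.real good := by linarith
  rw [measureReal_def] at h2
  have h3 := ENNReal.ofReal_le_of_le_toReal h2
  refine le_trans (le_of_eq ?_) h3
  rw [ENNReal.ofReal_div_of_pos (by norm_num)]
  norm_num

end Exponential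

/-! ### Nets for distances to subspaces -/

section Net

variable {d k s N : ℕ} {W V : Submodule ℝ (EuclideanSpace ℝ (Fin d))} {δ : ℝ}

/-- The net is the grid of mesh `1/N` in orthonormal coordinates of `W`. Rounding each of at most
`s` coordinates moves a point by at most `√s / N ≤ δ`. -/
theorem exists_net_unitBall (hW : Module.finrank ℝ W ≤ s) (hN : 0 < N) (hδ : 0 ≤ δ)
    (hs : (s : ℝ) ≤ (δ * N) ^ 2) :
    ∃ G : Finset (EuclideanSpace ℝ (Fin d)), G.card ≤ (2 * N + 1) ^ s ∧
      ∀ u ∈ W, ‖u‖ ≤ 1 → ∃ g ∈ G, ‖u - g‖ ≤ δ := by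
  classical
  let v := stdOrthonormalBasis ℝ W
  have hN' : (0 : ℝ) < N := by exact_mod_cast hN
  let F : (Fin (Module.finrank ℝ W) → ℤ) → EuclideanSpace ℝ (Fin d) := fun c =>
    ((∑ j, ((c j : ℝ) / N) • v j : W) : EuclideanSpace ℝ (Fin d))
  refine ⟨(Fintype.piFinset fun _ => Finset.Icc (-(N : ℤ)) N).image F, ?_, fun u hu hu1 => ?_⟩
  · refine Finset.card_image_le.trans ?_
    rw [Fintype.card_piFinset_const, Int.card_Icc]
    have h : ((N : ℤ) + 1 - -(N : ℤ)).toNat = 2 * N + 1 := by omega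
    rw [h]
    exact Nat.pow_le_pow_right (by omega) hW
  · set y : W := ⟨u, hu⟩ with hy
    have hy1 : ‖y‖ ≤ 1 := hu1
    let c : Fin (Module.finrank ℝ W) → ℤ := fun j => round (N * inner ℝ (v j) y)
    have hc : ∀ j, c j ∈ Finset.Icc (-(N : ℤ)) N := by
      intro j
      have h1 : |inner ℝ (v j) y| ≤ 1 := by
        refine (abs_real_inner_le_norm _ _).trans ?_
        rw [v.orthonormal.1 j, one_mul]
        exact hy1
      have h2 := abs_le.mp h1
      have h3 := abs_le.mp (abs_sub_round (N * inner ℝ (v j) y : ℝ))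
      have h4 : ((c j : ℤ) : ℝ) < N + 1 := by
        change ((round (N * inner ℝ (v j) y) : ℤ) : ℝ) < N + 1
        nlinarith
      have h5 : -(N : ℝ) - 1 < ((c j : ℤ) : ℝ) := by
        change -(N : ℝ) - 1 < ((round (N * inner ℝ (v j) y) : ℤ) : ℝ)
        nlinarith
      have h6 : c j < N + 1 := by exact_mod_cast h4
      have h7 : -(N : ℤ) - 1 < c j := by exact_mod_cast h5
      rw [Finset.mem_Icc]
      omega
    refine ⟨F c, Finset.mem_image_of_mem _ (Fintype.mem_piFinset.mpr hc), ?_⟩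
    have hdiff : u - F c = ((y - ∑ j, ((c j : ℝ) / N) • v j : W) : EuclideanSpace ℝ (Fin d)) := rfl
    rw [hdiff, ← Submodule.coe_norm]
    refine abs_le_of_sq_le_sq' ?_ hδ |>.2
    rw [← v.sum_sq_norm_inner_right]
    have hcoord : ∀ j, ‖inner ℝ (v j) (y - ∑ i, ((c i : ℝ) / N) • v i)‖ ^ 2 ≤ 1 / (N : ℝ) ^ 2 := by
      intro j
      rw [inner_sub_right, v.orthonormal.inner_right_fintype, Real.norm_eq_abs, sq_abs]
      have h3 := abs_sub_round (N * inner ℝ (v j) y : ℝ)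
      have h4 : inner ℝ (v j) y - (c j : ℝ) / N = (N * inner ℝ (v j) y - (c j : ℝ)) / N := by
        field_simp
      rw [h4, div_pow]
      refine div_le_div_of_nonneg_right ?_ (by positivity)
      rw [← sq_abs]
      have h5 : |(N * inner ℝ (v j) y - (c j : ℝ))| ≤ 1 := h3.trans (by norm_num)
      exact pow_le_one₀ (abs_nonneg _) h5
    refine (Finset.sum_le_card_nsmul _ _ _ fun j _ => hcoord j).trans ?_
    rw [nsmul_eq_mul, Finset.card_univ, Fintype.card_fin, mul_one_div, div_le_iff₀ (by positivity),
      ← mul_pow]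
    exact (Nat.cast_le.mpr hW).trans hs

/-- The square root of the quadratic form `‖w‖² - ∑_j ⟪g_j, w⟫²`, which is the distance to the
span of the `g_j` when these are orthonormal. -/
noncomputable def residual (g : Fin k → EuclideanSpace ℝ (Fin d)) (w : EuclideanSpace ℝ (Fin d)) :
    ℝ :=
  √(‖w‖ ^ 2 - ∑ j, inner ℝ (g j) w ^ 2)

theorem distTo_sq_eq_of_orthonormalBasis (v : OrthonormalBasis (Fin k) ℝ V)
    (w : EuclideanSpace ℝ (Fin d)) :
    distTo V w ^ 2 = ‖w‖ ^ 2 - ∑ j, inner ℝ (v j : EuclideanSpace ℝ (Fin d)) w ^ 2 := by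
  rw [distTo_sq]
  congr 1
  have h3 : ‖V.starProjection w‖ = ‖V.orthogonalProjectionOnto w‖ := rfl
  rw [h3, ← v.sum_sq_norm_inner_right]
  refine Finset.sum_congr rfl fun j _ => ?_
  rw [Real.norm_eq_abs, sq_abs, Submodule.coe_inner]
  congr 1
  exact V.inner_orthogonalProjectionOnto_eq_of_mem_left _ _

theorem abs_sum_inner_sq_sub_le {u g : Fin k → EuclideanSpace ℝ (Fin d)}
    (hu : ∀ j, ‖u j‖ ≤ 1) (hg : ∀ j, ‖u j - g j‖ ≤ δ) (hδ : δ ≤ 1)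
    (w : EuclideanSpace ℝ (Fin d)) :
    |∑ j, inner ℝ (u j) w ^ 2 - ∑ j, inner ℝ (g j) w ^ 2| ≤ 3 * k * δ * ‖w‖ ^ 2 := by
  rw [← Finset.sum_sub_distrib]
  refine (Finset.abs_sum_le_sum_abs _ _).trans ?_
  have h : ∀ j ∈ Finset.univ, |inner ℝ (u j) w ^ 2 - inner ℝ (g j) w ^ 2| ≤ 3 * δ * ‖w‖ ^ 2 := by
    intro j _
    have h1 : inner ℝ (u j) w ^ 2 - inner ℝ (g j) w ^ 2 =
        inner ℝ (u j - g j) w * inner ℝ (u j + g j) w := by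
      rw [inner_sub_left, inner_add_left]
      ring
    have h0 : 0 ≤ δ := (norm_nonneg _).trans (hg j)
    have h2 : ‖u j + g j‖ ≤ 3 := by
      have h3 : u j + g j = (2 : ℝ) • u j - (u j - g j) := by
        rw [two_smul]; abel
      rw [h3]
      refine (norm_sub_le _ _).trans ?_
      rw [norm_smul]
      norm_num
      linarith [hu j, hg j]
    rw [h1, abs_mul]
    calc |inner ℝ (u j - g j) w| * |inner ℝ (u j + g j) w|
        ≤ (δ * ‖w‖) * (3 * ‖w‖) := by
          refine mul_le_mul ?_ ?_ (abs_nonneg _) (by positivity)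
          · exact (abs_real_inner_le_norm _ _).trans
              (mul_le_mul_of_nonneg_right (hg j) (norm_nonneg _))
          · exact (abs_real_inner_le_norm _ _).trans
              (mul_le_mul_of_nonneg_right h2 (norm_nonneg _))
      _ = _ := by ring
  refine (Finset.sum_le_card_nsmul _ _ _ h).trans_eq ?_
  rw [nsmul_eq_mul, Finset.card_univ, Fintype.card_fin]
  ring

/-- For `w ∈ W` the inner products with an orthonormal basis of `V` only see its projections to `W`.
Discretizing these projections rather than `V` makes the net depend on `s` and not on `d`. -/
theorem exists_net_distTo (hW : Module.finrank ℝ W ≤ s) (hN : 0 < N) (hδ : 0 ≤ δ) (hδ1 : δ ≤ 1)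
    (hs : (s : ℝ) ≤ (δ * N) ^ 2) (k : ℕ) :
    ∃ G : Finset (Fin k → EuclideanSpace ℝ (Fin d)), G.card ≤ ((2 * N + 1) ^ s) ^ k ∧
      ∀ V : Submodule ℝ (EuclideanSpace ℝ (Fin d)), Module.finrank ℝ V = k →
        ∃ g ∈ G, ∀ w ∈ W, distTo V w ≤ residual g w + √(3 * k * δ) * ‖w‖ ∧
          residual g w ≤ distTo V w + √(3 * k * δ) * ‖w‖ := by
  classical
  obtain ⟨G, hcard, hG⟩ := exists_net_unitBall hW hN hδ hs
  refine ⟨Fintype.piFinset fun _ => G, ?_, fun V hV => ?_⟩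
  · rw [Fintype.card_piFinset_const]
    exact Nat.pow_le_pow_left hcard k
  · let v := (stdOrthonormalBasis ℝ V).reindex (finCongr hV)
    let u : Fin k → EuclideanSpace ℝ (Fin d) := fun j => W.starProjection (v j)
    have hu : ∀ j, ‖u j‖ ≤ 1 := fun j => by
      refine (W.norm_starProjection_apply_le _).trans ?_
      exact (v.orthonormal.1 j).le
    have hex : ∀ j, ∃ g ∈ G, ‖u j - g‖ ≤ δ := fun j =>
      hG _ (W.starProjection_apply_mem _) (hu j)
    choose g hgG hg using hex
    refine ⟨g, Fintype.mem_piFinset.mpr hgG, fun w hw => ?_⟩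
    have h1 : distTo V w ^ 2 = ‖w‖ ^ 2 - ∑ j, inner ℝ (u j) w ^ 2 := by
      rw [distTo_sq_eq_of_orthonormalBasis v]
      congr 1
      refine Finset.sum_congr rfl fun j _ => ?_
      rw [Submodule.inner_starProjection_left_eq_right, Submodule.starProjection_eq_self_iff.mpr hw]
    have h2 := abs_le.mp (abs_sum_inner_sq_sub_le hu hg hδ1 w)
    have h3 : residual g w ^ 2 = max (‖w‖ ^ 2 - ∑ j, inner ℝ (g j) w ^ 2) 0 := Real.sq_sqrt'
    have h4 : (√(3 * k * δ) * ‖w‖) ^ 2 = 3 * k * δ * ‖w‖ ^ 2 := by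
      rw [mul_pow, Real.sq_sqrt (by positivity)]
    have h5 : 0 ≤ √(3 * k * δ) * ‖w‖ := by positivity
    have h6 : 0 ≤ residual g w := Real.sqrt_nonneg _
    have h7 : 0 ≤ distTo V w := distTo_nonneg
    have h8 := le_max_left (‖w‖ ^ 2 - ∑ j, inner ℝ (g j) w ^ 2) 0
    constructor
    · refine abs_le_of_sq_le_sq' ?_ (by positivity) |>.2
      nlinarith [mul_nonneg h5 h6]
    · refine abs_le_of_sq_le_sq' ?_ (by positivity) |>.2
      have h9 : residual g w ^ 2 ≤ distTo V w ^ 2 + 3 * k * δ * ‖w‖ ^ 2 := by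
        rw [h3]
        refine max_le (by linarith) (by positivity)
      nlinarith [mul_nonneg h5 h7]

end Net

/-! ### Comparison of the costs -/

section Cost

variable {n d k : ℕ} {p : ℝ} {A : Matrix (Fin n) (Fin d) ℝ}
  {V : Submodule ℝ (EuclideanSpace ℝ (Fin d))}

theorem lpCost_nonneg : 0 ≤ lpCost p A V :=
  Real.rpow_nonneg (Finset.sum_nonneg fun _ _ => Real.rpow_nonneg distTo_nonneg _) _

theorem lpCost_rpow (hp : 1 ≤ p) : lpCost p A V ^ p = ∑ i, distTo V (row A i) ^ p := by
  rw [lpCost, one_div, Real.rpow_inv_rpow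
    (Finset.sum_nonneg fun _ _ => Real.rpow_nonneg distTo_nonneg _) (by linarith)]

theorem lpCost_eq_zero_of_rowspace_le (hp : 1 ≤ p) (h : rowspace A ≤ V) : lpCost p A V = 0 := by
  have h0 : ∀ i, distTo V (row A i) = 0 := fun i =>
    distTo_eq_zero_iff.mpr (h (Submodule.subset_span (Set.mem_range_self i)))
  have hp0 : p ≠ 0 := by linarith
  simp [lpCost, h0, Real.zero_rpow hp0, hp0]

theorem distTo_le_lpCost (hp : 1 ≤ p) (t : Fin n) : distTo V (row A t) ≤ lpCost p A V := by
  rw [← Real.rpow_le_rpow_iff distTo_nonneg lpCost_nonneg (by linarith : 0 < p), lpCost_rpow hp]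
  exact Finset.single_le_sum (f := fun i => distTo V (row A i) ^ p)
    (fun i _ => Real.rpow_nonneg distTo_nonneg _) (Finset.mem_univ t)

theorem sigmaOnline_sq_le_lpCost (hp : 1 ≤ p) (hA : k < Module.finrank ℝ (rowspace A))
    (hV : Module.finrank ℝ V ≤ k) : sigmaOnline k A ^ 2 ≤ n * lpCost p A V ^ 2 := by
  refine (sigmaOnline_sq_le_sum_distTo hA hV).trans ?_
  refine (Finset.sum_le_card_nsmul _ _ _ fun i _ =>
    pow_le_pow_left₀ distTo_nonneg (distTo_le_lpCost hp i) 2).trans_eq ?_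
  rw [nsmul_eq_mul, Finset.card_univ, Fintype.card_fin]

/-- Since the rank exceeds `k`, the infimum of the costs is positive, at least `sigmaOnline / n`. A
minimizer up to the factor `2` thus exists without any compactness argument. -/
theorem exists_lpCost_le_two_mul (hp : 1 ≤ p) (hA : k < Module.finrank ℝ (rowspace A))
    (hV : Module.finrank ℝ V = k) :
    ∃ W : Submodule ℝ (EuclideanSpace ℝ (Fin d)), Module.finrank ℝ W = k ∧
      ∀ U : Submodule ℝ (EuclideanSpace ℝ (Fin d)), Module.finrank ℝ U = k →
        lpCost p A W ≤ 2 * lpCost p A U := by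
  set T : Set ℝ := {c | ∃ U : Submodule ℝ (EuclideanSpace ℝ (Fin d)),
    Module.finrank ℝ U = k ∧ lpCost p A U = c} with hT
  have hbdd : BddBelow T := ⟨0, by rintro _ ⟨U, -, rfl⟩; exact lpCost_nonneg⟩
  have hne : T.Nonempty := ⟨_, V, hV, rfl⟩
  have hσ := sigmaOnline_pos_of_lt hA
  have hpos : 0 < sInf T := by
    have hn : (1 : ℝ) ≤ n := by
      have := finrank_rowspace_le (A := A)
      exact_mod_cast (by omega : 1 ≤ n)
    have h1 : sigmaOnline k A / n ≤ sInf T := by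
      refine le_csInf hne ?_
      rintro _ ⟨U, hU, rfl⟩
      have h2 := sigmaOnline_sq_le_lpCost hp hA hU.le
      have h3 : (0 : ℝ) ≤ lpCost p A U := lpCost_nonneg
      rw [div_le_iff₀ (by linarith)]
      refine abs_le_of_sq_le_sq' ?_ (by positivity) |>.2
      nlinarith [sq_nonneg (lpCost p A U)]
    exact lt_of_lt_of_le (by positivity) h1
  obtain ⟨_, ⟨W, hW, rfl⟩, hlt⟩ := exists_lt_of_csInf_lt hne (show sInf T < 2 * sInf T by linarith)
  refine ⟨W, hW, fun U hU => hlt.le.trans ?_⟩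
  have := csInf_le hbdd (show lpCost p A U ∈ T from ⟨U, hU, rfl⟩)
  linarith

end Cost

/-! ### Comparison of the costs on the event of large probability -/

section Compare

variable {n d k : ℕ} {p : ℝ} {A : Matrix (Fin n) (Fin d) ℝ}
  {V W : Submodule ℝ (EuclideanSpace ℝ (Fin d))}

/-- The `p`-th powers of upper bounds for the distances of the rows to subspaces near to the one
described by `g`. -/
noncomputable def netWeight (p : ℝ) (A : Matrix (Fin n) (Fin d) ℝ)
    (W : Submodule ℝ (EuclideanSpace ℝ (Fin d))) (η : ℝ) (g : Fin k → EuclideanSpace ℝ (Fin d))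
    (t : Fin n) : ℝ :=
  (distTo W (row A t) + residual g (W.starProjection (row A t)) + η) ^ p

theorem netWeight_base_nonneg {η : ℝ} (hη : 0 ≤ η) (g : Fin k → EuclideanSpace ℝ (Fin d))
    (t : Fin n) :
    0 ≤ distTo W (row A t) + residual g (W.starProjection (row A t)) + η :=
  add_nonneg (add_nonneg distTo_nonneg (Real.sqrt_nonneg _)) hη

/-- The net weights bound `d(a_j, V)^p` for all `j`. At the one index `i` where `e i` is small
relative to the weight, the scaled bounds by `Y` give a weight of at most `e i * (5Y)^p`; so the sum
of all weights is at most `R (5Y)^p`. -/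
theorem lpCost_le_of_netWeight (hp : 1 ≤ p) {D e : Fin n → ℝ} {Y R η c : ℝ}
    {g : Fin k → EuclideanSpace ℝ (Fin d)} (he : ∀ i, 0 < e i)
    (hDe : ∀ i, e i ^ (-1 / p) ≤ D i) (hη0 : 0 ≤ η) (hc0 : 0 ≤ c) (hR : 0 ≤ R)
    (hV : ∀ t, D t * distTo V (row A t) ≤ Y) (hW : ∀ t, D t * distTo W (row A t) ≤ Y)
    (hη : ∀ t, D t * η ≤ Y)
    (hg : ∀ w ∈ W, distTo V w ≤ residual g w + c * ‖w‖ ∧ residual g w ≤ distTo V w + c * ‖w‖)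
    (hc : ∀ t, c * ‖row A t‖ ≤ η) {i : Fin n}
    (hi : e i * ∑ j, netWeight p A W η g j ≤ R * netWeight p A W η g i) :
    lpCost p A V ≤ R ^ (1 / p) * (5 * Y) := by
  have hp0 : 0 < p := by linarith
  have hproj : ∀ t, c * ‖W.starProjection (row A t)‖ ≤ η := fun t =>
    (mul_le_mul_of_nonneg_left (W.norm_starProjection_apply_le _) hc0).trans (hc t)
  have hD0 : ∀ t, 0 ≤ D t := fun t => (Real.rpow_nonneg (he t).le _).trans (hDe t)
  have h1 : ∀ t, distTo V (row A t) ≤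
      distTo W (row A t) + residual g (W.starProjection (row A t)) + η := by
    intro t
    have h2 : distTo V (row A t) ≤ distTo V (row A t - W.starProjection (row A t)) +
        distTo V (W.starProjection (row A t)) := by
      simpa using distTo_add_le (V := V) (x := row A t - W.starProjection (row A t))
        (y := W.starProjection (row A t))
    have h3 : distTo V (row A t - W.starProjection (row A t)) ≤ distTo W (row A t) :=
      distTo_le_norm
    have h4 := (hg _ (W.starProjection_apply_mem (row A t))).1
    linarith [hproj t]
  have h2 : D i * (distTo W (row A i) + residual g (W.starProjection (row A i)) + η) ≤ 5 * Y := by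
    have h3 : distTo V (W.starProjection (row A i)) ≤ distTo W (row A i) + distTo V (row A i) := by
      have h4 : distTo V (W.starProjection (row A i)) ≤
          distTo V (-(row A i - W.starProjection (row A i))) + distTo V (row A i) := by
        simpa using distTo_add_le (V := V) (x := -(row A i - W.starProjection (row A i)))
          (y := row A i)
      have h5 : distTo V (-(row A i - W.starProjection (row A i))) ≤ distTo W (row A i) := by
        refine distTo_le_norm.trans_eq ?_
        rw [norm_neg]
        rfl
      linarith
    have h4 := (hg _ (W.starProjection_apply_mem (row A i))).2
    -- Multiplied by `D i`, each of the `2 + 1 + 2` terms on the right is at most `Y`, hence the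
    -- constant `5`.
    have h5 : distTo W (row A i) + residual g (W.starProjection (row A i)) + η ≤
        2 * distTo W (row A i) + distTo V (row A i) + 2 * η := by linarith [hproj i]
    have h6 := mul_le_mul_of_nonneg_left h5 (hD0 i)
    linarith [hV i, hW i, hη i]
  have hb := netWeight_base_nonneg (W := W) (A := A) hη0 g i
  have h3 : netWeight p A W η g i ≤ e i * (5 * Y) ^ p := by
    have h4 : e i ^ (-1 / p) *
        (distTo W (row A i) + residual g (W.starProjection (row A i)) + η) ≤ 5 * Y :=
      (mul_le_mul_of_nonneg_right (hDe i) hb).trans h2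
    have h5 := Real.rpow_le_rpow (mul_nonneg (Real.rpow_nonneg (he i).le _) hb) h4 hp0.le
    rw [Real.mul_rpow (Real.rpow_nonneg (he i).le _) hb, ← Real.rpow_mul (he i).le,
      div_mul_cancel₀ _ hp0.ne', Real.rpow_neg_one, inv_mul_le_iff₀ (he i)] at h5
    exact h5
  have hY : 0 ≤ 5 * Y := (mul_nonneg (hD0 i) hb).trans h2
  have h4 : ∑ j, distTo V (row A j) ^ p ≤ R * (5 * Y) ^ p := by
    have h5 : ∑ j, distTo V (row A j) ^ p ≤ ∑ j, netWeight p A W η g j :=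
      Finset.sum_le_sum fun j _ => Real.rpow_le_rpow distTo_nonneg (h1 j) hp0.le
    refine h5.trans (le_of_mul_le_mul_left ?_ (he i))
    refine hi.trans ((mul_le_mul_of_nonneg_left h3 hR).trans_eq ?_)
    ring
  calc lpCost p A V = (∑ j, distTo V (row A j) ^ p) ^ (1 / p) := rfl
    _ ≤ (R * (5 * Y) ^ p) ^ (1 / p) :=
        Real.rpow_le_rpow (Finset.sum_nonneg fun _ _ => Real.rpow_nonneg distTo_nonneg _) h4
          (by positivity)
    _ = R ^ (1 / p) * (5 * Y) := by
        rw [Real.mul_rpow hR (Real.rpow_nonneg hY _), one_div, Real.rpow_rpow_inv hY hp0.ne']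

theorem row_scaling_mul (x : Fin n → ℝ) (i : Fin n) :
    row (scaling p x * A) i = ((⌈x i ^ (-1 / p)⌉ : ℤ) : ℝ) • row A i := by
  ext j
  simp [row, scaling, Matrix.diagonal_mul]

theorem one_le_ceil_rpow {x : ℝ} (hx : 0 < x) : (1 : ℝ) ≤ ((⌈x ^ (-1 / p)⌉ : ℤ) : ℝ) := by
  have h : 0 < ⌈x ^ (-1 / p)⌉ := Int.ceil_pos.mpr (Real.rpow_pos_of_pos hx _)
  exact_mod_cast h

theorem ceil_rpow_le (hp : 1 ≤ p) {x : ℝ} (hn : 1 ≤ n) (hx : 1 / (100 * n) ≤ x) :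
    ((⌈x ^ (-1 / p)⌉ : ℤ) : ℝ) ≤ 101 * n := by
  have hn' : (1 : ℝ) ≤ n := by exact_mod_cast hn
  have h0 : (0 : ℝ) < 1 / (100 * n) := by positivity
  have hp0 : 0 < p := by linarith
  have h1 : x ^ (-1 / p) ≤ 100 * n := by
    calc x ^ (-1 / p) ≤ (1 / (100 * n) : ℝ) ^ (-1 / p) :=
          Real.rpow_le_rpow_of_nonpos h0 hx (div_nonpos_of_nonpos_of_nonneg (by norm_num) hp0.le)
      _ = (100 * n : ℝ) ^ (1 / p) := by
          rw [one_div, Real.inv_rpow (by positivity), ← Real.rpow_neg (by positivity), neg_div,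
            neg_neg]
      _ ≤ (100 * n : ℝ) ^ (1 : ℝ) :=
          Real.rpow_le_rpow_of_exponent_le (by linarith) ((div_le_one hp0).mpr hp)
      _ = 100 * n := Real.rpow_one _
  linarith [Int.ceil_lt_add_one (x ^ (-1 / p))]

theorem ceil_rpow_mul_distTo_le (hp : 1 ≤ p) {e : Fin n → ℝ} (he : ∀ i, 0 < e i) {i : Fin n}
    (h : distTo V (row A i) ^ p / (100 * lpCost p A V ^ p) ≤ e i) (hpos : 0 < lpCost p A V) :
    ((⌈e i ^ (-1 / p)⌉ : ℤ) : ℝ) * distTo V (row A i) ≤ 101 * lpCost p A V := by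
  have hp0 : 0 < p := by linarith
  have hd : 0 ≤ distTo V (row A i) := distTo_nonneg
  have h1 : distTo V (row A i) ≤ e i ^ (1 / p) * (100 * lpCost p A V) := by
    have h2 : distTo V (row A i) ^ p ≤ e i * (100 * lpCost p A V) ^ p := by
      have h3 : (0 : ℝ) < lpCost p A V ^ p := Real.rpow_pos_of_pos hpos p
      rw [div_le_iff₀ (by positivity)] at h
      refine h.trans (mul_le_mul_of_nonneg_left ?_ (he i).le)
      rw [Real.mul_rpow (by norm_num) hpos.le]
      refine mul_le_mul_of_nonneg_right ?_ h3.le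
      calc (100 : ℝ) = 100 ^ (1 : ℝ) := (Real.rpow_one _).symm
        _ ≤ 100 ^ p := Real.rpow_le_rpow_of_exponent_le (by norm_num) hp
    have h3 := Real.rpow_le_rpow (Real.rpow_nonneg hd _) h2 (show 0 ≤ 1 / p by positivity)
    rwa [Real.mul_rpow (he i).le (by positivity), one_div, Real.rpow_rpow_inv hd hp0.ne',
      Real.rpow_rpow_inv (by positivity) hp0.ne', ← one_div] at h3
  have h2 : e i ^ (-1 / p) * distTo V (row A i) ≤ 100 * lpCost p A V := by
    have h3 := mul_le_mul_of_nonneg_left h1 (Real.rpow_nonneg (he i).le (-1 / p))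
    rwa [← mul_assoc, ← Real.rpow_add (he i), neg_div, neg_add_cancel, Real.rpow_zero, one_mul,
      ← neg_div] at h3
  have h3 := mul_le_mul_of_nonneg_right (Int.ceil_lt_add_one (e i ^ (-1 / p))).le hd
  linarith [distTo_le_lpCost (V := V) (A := A) hp i]

end Compare

/-! ### Numerical estimates -/

section Numeric

variable {n d k : ℕ} {A B : Matrix (Fin n) (Fin d) ℝ} {D : Fin n → ℝ}

theorem two_le_mul_onlineCond (hk : 1 ≤ k) (hA : k < Module.finrank ℝ (rowspace A)) :
    2 ≤ n * onlineCond k A := by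
  have h1 := finrank_rowspace_le (A := A)
  have hn : (2 : ℝ) ≤ n := by exact_mod_cast (by omega : 2 ≤ n)
  nlinarith [one_le_onlineCond hA]

theorem log_mul_onlineCond_ge (hk : 1 ≤ k) (hA : k < Module.finrank ℝ (rowspace A)) :
    2 / 3 ≤ Real.log (n * onlineCond k A) := by
  have h := Real.log_le_log (by norm_num) (two_le_mul_onlineCond hk hA)
  linarith [Real.log_two_gt_d9]

theorem sum_norm_row_sq_le (hrow : ∀ i, row B i = D i • row A i) (hD : ∀ i, 1 ≤ D i)
    (hD' : ∀ i, D i ≤ 101 * n) :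
    ∑ i, ‖row B i‖ ^ 2 ≤ n * (101 * n * opNorm A) ^ 2 := by
  have h : ∀ i ∈ Finset.univ, ‖row B i‖ ^ 2 ≤ (101 * n * opNorm A) ^ 2 := by
    intro i _
    refine pow_le_pow_left₀ (norm_nonneg _) ?_ 2
    rw [hrow, norm_smul, Real.norm_eq_abs, abs_of_nonneg (by linarith [hD i])]
    exact mul_le_mul (hD' i) (norm_row_le_opNorm i) (norm_nonneg _) (by positivity)
  refine (Finset.sum_le_card_nsmul _ _ _ h).trans_eq ?_
  rw [nsmul_eq_mul, Finset.card_univ, Fintype.card_fin]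

theorem card_coreset_le_log (hk : 1 ≤ k) (hA : k < Module.finrank ℝ (rowspace A))
    (hrow : ∀ i, row B i = D i • row A i) (hD : ∀ i, 1 ≤ D i) (hD' : ∀ i, D i ≤ 101 * n) :
    ((coreset k B).card : ℝ) ≤ 6300 * k * Real.log (n * onlineCond k A) ^ 2 := by
  have hcard := card_coreset_le hk hA hrow hD (sum_norm_row_sq_le hrow hD hD')
  have hσ := sigmaOnline_pos_of_lt hA
  have hκ := one_le_onlineCond hA
  have hx := two_le_mul_onlineCond hk hA
  have hL := log_mul_onlineCond_ge hk hA
  have hrank := finrank_rowspace_le (A := A)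
  have hkn : (k : ℝ) ≤ n := by exact_mod_cast (by omega : k ≤ n)
  have hk1 : (1 : ℝ) ≤ k := by exact_mod_cast hk
  have hn0 : (0 : ℝ) < n := by linarith
  -- The ratio is `20402 n⁴ k κ²`. As `n κ ≥ 2`, the numerical constant is absorbed into `15`
  -- further powers of `n κ`.
  have harg : 1 + 2 * (n * (101 * n * opNorm A) ^ 2) / lamMin k A ≤
      (n * onlineCond k A) ^ 20 := by
    rw [← onlineCond_mul_sigmaOnline hA, lamMin]
    have h1 : 2 * (n * (101 * n * (onlineCond k A * sigmaOnline k A)) ^ 2) /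
        (sigmaOnline k A ^ 2 / n / k) = 20402 * (n ^ 4 * k) * onlineCond k A ^ 2 := by
      field_simp
      ring
    have h2 : 20402 * ((n : ℝ) ^ 4 * k) * onlineCond k A ^ 2 ≤
        20402 * (n * onlineCond k A) ^ 5 := by
      have h3 : (n : ℝ) ^ 4 * k ≤ n ^ 5 := by
        rw [pow_succ (n : ℝ) 4]
        gcongr
      have h4 : onlineCond k A ^ 2 ≤ onlineCond k A ^ 5 := pow_le_pow_right₀ hκ (by norm_num)
      rw [mul_pow, mul_assoc]
      gcongr
    have h5 : (1 : ℝ) ≤ (n * onlineCond k A) ^ 5 := one_le_pow₀ (by linarith)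
    have h6 : (2 : ℝ) ^ 15 ≤ (n * onlineCond k A) ^ 15 := pow_le_pow_left₀ (by norm_num) hx 15
    rw [h1]
    calc 1 + 20402 * ((n : ℝ) ^ 4 * k) * onlineCond k A ^ 2
        ≤ 2 ^ 15 * (n * onlineCond k A) ^ 5 := by linarith
      _ ≤ (n * onlineCond k A) ^ 15 * (n * onlineCond k A) ^ 5 := by gcongr
      _ = _ := by ring
  have hmin := lamMin_pos hk hA
  set L := Real.log (n * onlineCond k A) with hLdef
  have hΛ : Real.log (1 + 2 * (n * (101 * n * opNorm A) ^ 2) / lamMin k A) ≤ 20 * L := by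
    refine (Real.log_le_log (by positivity) harg).trans_eq ?_
    rw [Real.log_pow, ← hLdef]
    norm_num
  have hΛ0 : 0 ≤ Real.log (1 + 2 * (n * (101 * n * opNorm A) ^ 2) / lamMin k A) :=
    Real.log_nonneg (le_add_of_nonneg_right (by positivity))
  set Λ := Real.log (1 + 2 * (n * (101 * n * opNorm A) ^ 2) / lamMin k A) with hΛdef
  have h1 : 2 * Λ + 1 ≤ 42 * L := by linarith
  have h2 : 1 + 5 * k * (6 + Λ) ≤ 150 * k * L := by
    have h3 : 5 * (k : ℝ) * (6 + Λ) ≤ 5 * k * (9 * L + 20 * L) :=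
      mul_le_mul_of_nonneg_left (by linarith) (by linarith)
    nlinarith
  refine hcard.trans ?_
  calc (2 * Λ + 1) * (1 + 5 * k * (6 + Λ)) ≤ (42 * L) * (150 * k * L) :=
        mul_le_mul h1 h2 (by positivity) (by linarith)
    _ = _ := by ring

end Numeric

/-! ### Parameters of the net -/

section Parameters

variable {n k s : ℕ} {x L : ℝ}

/-- The fineness of the net, as a function of `n κ`. -/
noncomputable def netFineness (x : ℝ) : ℕ := ⌈2448240 * x ^ 6⌉₊

theorem le_netFineness : 2448240 * x ^ 6 ≤ netFineness x := Nat.le_ceil _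

theorem netFineness_pos (hx : 2 ≤ x) : 0 < netFineness x :=
  Nat.ceil_pos.mpr (by positivity)

/-- Here `80² ≥ 6300`, `30603 = 3 · 101²` is the constant required for `D η ≤ Y`, and `2448240 = 80
· 30603`. -/
theorem sqrt_div_netFineness_le (hx : 2 ≤ x) (hkx : (k : ℝ) ≤ x) (hL0 : 0 ≤ L) (hLx : L ≤ x)
    (hs : (s : ℝ) ≤ 6300 * k * L ^ 2) : √(s : ℝ) / netFineness x ≤ 1 / (30603 * x ^ 4) := by
  have h1 : √(s : ℝ) ≤ 80 * x ^ 2 := by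
    rw [Real.sqrt_le_left (by positivity)]
    have h2 : (k : ℝ) * L ^ 2 ≤ x * x ^ 2 :=
      mul_le_mul hkx (pow_le_pow_left₀ hL0 hLx 2) (by positivity) (by linarith)
    have h3 : x * x ^ 2 ≤ x ^ 4 := by
      calc x * x ^ 2 = x ^ 3 := by ring
        _ ≤ x ^ 4 := pow_le_pow_right₀ (by linarith) (by norm_num)
    have h4 : (80 * x ^ 2) ^ 2 = 6400 * x ^ 4 := by ring
    have h5 : 0 ≤ x ^ 4 := by positivity
    rw [h4]
    linarith
  have hx0 : 0 < x := by linarith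
  calc √(s : ℝ) / netFineness x ≤ (80 * x ^ 2) / (2448240 * x ^ 6) :=
        div_le_div₀ (by positivity) h1 (by positivity) le_netFineness
    _ = 1 / (30603 * x ^ 4) := by
        field_simp
        norm_num

/-- An upper bound for the number of elements of the net. -/
noncomputable def netCard (n k s : ℕ) (x : ℝ) : ℕ := n ^ s * ((2 * netFineness x + 1) ^ s) ^ k

/-- The dominant term is `k s log (2N + 1)`, of order `k² L³`; this is the source of the exponents
`2/p` and `3/p`. The factor `100` makes the union bound come out at `1/100`. -/
theorem log_netCard_le (hk : 1 ≤ k) (hn : 1 ≤ n) (hx : 2 ≤ x) (hnx : (n : ℝ) ≤ x)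
    (hL : L = Real.log x) (hL1 : 2 / 3 ≤ L) (hs : (s : ℝ) ≤ 6300 * k * L ^ 2) :
    Real.log (100 * netCard n k s x) ≤ 200000 * ((k : ℝ) ^ 2 * L ^ 3) := by
  have hx0 : 0 < x := by linarith
  have hn0 : (0 : ℝ) < n := by exact_mod_cast hn
  have hk1 : (1 : ℝ) ≤ k := by exact_mod_cast hk
  have hM0 : (0 : ℝ) < 2 * netFineness x + 1 := by positivity
  have h100 : Real.log 100 ≤ 7 * L := by
    have h1 : (100 : ℝ) ≤ x ^ 7 :=
      (by norm_num : (100 : ℝ) ≤ 2 ^ 7).trans (pow_le_pow_left₀ (by norm_num) hx 7)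
    refine (Real.log_le_log (by norm_num) h1).trans_eq ?_
    rw [Real.log_pow, ← hL]
    norm_num
  have hlogn : Real.log n ≤ L := hL ▸ Real.log_le_log hn0 hnx
  have hlogM : Real.log (2 * netFineness x + 1) ≤ 29 * L := by
    have h1 : (netFineness x : ℝ) < 2448240 * x ^ 6 + 1 := Nat.ceil_lt_add_one (by positivity)
    have h2 : (1 : ℝ) ≤ x ^ 6 := one_le_pow₀ (by linarith)
    have h3 : (2 : ℝ) ^ 23 ≤ x ^ 23 := pow_le_pow_left₀ (by norm_num) hx 23
    have h4 : 2 * (netFineness x : ℝ) + 1 ≤ x ^ 29 := by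
      calc 2 * (netFineness x : ℝ) + 1 ≤ 2 ^ 23 * x ^ 6 := by linarith
        _ ≤ x ^ 23 * x ^ 6 := by gcongr
        _ = x ^ 29 := by ring
    refine (Real.log_le_log hM0 h4).trans_eq ?_
    rw [Real.log_pow, ← hL]
    norm_num
  have hexp : Real.log (100 * netCard n k s x) =
      Real.log 100 + (s * Real.log n + k * (s * Real.log (2 * netFineness x + 1))) := by
    rw [netCard]
    push_cast
    rw [Real.log_mul (by norm_num) (by positivity), Real.log_mul (by positivity) (by positivity),
      Real.log_pow, Real.log_pow, Real.log_pow]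
  have hs0 : (0 : ℝ) ≤ s := Nat.cast_nonneg s
  have hL0 : 0 ≤ L := by linarith
  have h1 : (s : ℝ) * Real.log n ≤ 6300 * k * L ^ 2 * L :=
    mul_le_mul hs hlogn (Real.log_nonneg (by exact_mod_cast hn)) (by positivity)
  have h2 : (s : ℝ) * Real.log (2 * netFineness x + 1) ≤ 6300 * k * L ^ 2 * (29 * L) :=
    mul_le_mul hs hlogM (Real.log_nonneg (le_add_of_nonneg_left (by positivity))) (by positivity)
  have h3 := mul_le_mul_of_nonneg_left h2 (by linarith : (0 : ℝ) ≤ k)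
  have h4 : (k : ℝ) * L ^ 3 ≤ k ^ 2 * L ^ 3 :=
    mul_le_mul_of_nonneg_right (by nlinarith) (by positivity)
  have h5 : 7 * L ≤ 16 * ((k : ℝ) ^ 2 * L ^ 3) := by
    have h6 : 4 / 9 ≤ L ^ 2 := by nlinarith
    have h7 : L ^ 3 ≤ (k : ℝ) ^ 2 * L ^ 3 :=
      le_mul_of_one_le_left (by positivity) (one_le_pow₀ hk1)
    nlinarith
  rw [hexp]
  nlinarith

end Parameters

/-! ### The main theorem -/

section Main

variable {n d k : ℕ} {p : ℝ} {A : Matrix (Fin n) (Fin d) ℝ}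

theorem exists_range_eq_coe {s : ℕ} {S : Finset (Fin n)} (hne : S.Nonempty) (hs : S.card ≤ s) :
    ∃ f : Fin s → Fin n, Set.range f = (S : Set (Fin n)) := by
  have : Nonempty S := hne.to_subtype
  obtain ⟨φ⟩ := Function.Embedding.nonempty_of_card_le (α := S) (β := Fin s) (by simpa using hs)
  refine ⟨fun j => ((Function.invFun φ j : S) : Fin n), ?_⟩
  ext i
  constructor
  · rintro ⟨j, rfl⟩
    exact (Function.invFun φ j : S).2
  · intro hi
    obtain ⟨j, hj⟩ := Function.invFun_surjective φ.injective ⟨i, hi⟩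
    exact ⟨j, congrArg Subtype.val hj⟩

theorem exists_le_finrank_eq {E : Type*} [AddCommGroup E] [Module ℝ E] [FiniteDimensional ℝ E]
    {W : Submodule ℝ E} {m : ℕ} (hW : Module.finrank ℝ W ≤ m) (hm : m ≤ Module.finrank ℝ E) :
    ∃ U : Submodule ℝ E, W ≤ U ∧ Module.finrank ℝ U = m := by
  induction m, hW using Nat.le_induction with
  | base => exact ⟨W, le_rfl, rfl⟩
  | succ m _ ih =>
    obtain ⟨U, hle, hU⟩ := ih (by omega)
    have hne : U ≠ ⊤ := by
      rintro rfl
      rw [finrank_top] at hU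
      omega
    obtain ⟨x, -, hx⟩ := SetLike.exists_of_lt (lt_top_iff_ne_top.mpr hne)
    refine ⟨U ⊔ Submodule.span ℝ {x}, hle.trans le_sup_left, ?_⟩
    rw [Submodule.finrank_sup_span_singleton hx, hU]

theorem isApproxSolution_of_finrank_le (hk : 1 ≤ k) (hp : 1 ≤ p)
    (hA : Module.finrank ℝ (rowspace A) ≤ k) {x : Fin n → ℝ} (hx : ∀ i, 0 < x i) {β c : ℝ}
    (hc : 0 ≤ c) {V : Submodule ℝ (EuclideanSpace ℝ (Fin d))}
    (h : IsApproxSolution k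
      (linfCost (restrictRows (scaling p x * A) (coreset k (scaling p x * A)))) β V) :
    IsApproxSolution k (lpCost p A) (β * c) V := by
  set B := scaling p x * A with hB
  have hrow := row_scaling_mul (p := p) (A := A) x
  have hD : ∀ i, (1 : ℝ) ≤ ((⌈x i ^ (-1 / p)⌉ : ℤ) : ℝ) := fun i => one_le_ceil_rpow (hx i)
  have hspace : rowspace B = rowspace A := by
    have h1 := span_row_image_scaled hrow hD Set.univ
    rwa [Set.image_univ, Set.image_univ] at h1
  have hspan := span_coreset_of_finrank_le (B := B) hk (hspace ▸ hA)
  rw [hspace] at hspan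
  have hzero : ∀ W : Submodule ℝ (EuclideanSpace ℝ (Fin d)),
      linfCost (restrictRows B (coreset k B)) W ≤ 0 → lpCost p A W = 0 := by
    intro W hW
    refine lpCost_eq_zero_of_rowspace_le hp ?_
    rw [← hspan, Submodule.span_le]
    rintro _ ⟨i, hi, rfl⟩
    exact distTo_eq_zero_iff.mp
      (le_antisymm ((distTo_le_linfCost_restrictRows hi).trans hW) distTo_nonneg)
  have hV0 : linfCost (restrictRows B (coreset k B)) V ≤ 0 := by
    obtain ⟨U, hU, hle⟩ : ∃ U : Submodule ℝ (EuclideanSpace ℝ (Fin d)),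
        Module.finrank ℝ U = k ∧ rowspace A ≤ U := by
      obtain ⟨U, hle, hU⟩ := exists_le_finrank_eq hA (h.1 ▸ Submodule.finrank_le V)
      exact ⟨U, hU, hle⟩
    have h1 : linfCost (restrictRows B (coreset k B)) U = 0 := by
      refine le_antisymm (linfCost_restrictRows_le le_rfl fun i hi => ?_) (linfCost_nonneg _)
      rw [distTo_eq_zero_iff.mpr]
      exact hle (hspan ▸ Submodule.subset_span (Set.mem_image_of_mem _ hi))
    simpa [h1] using h.2 U hU
  refine ⟨h.1, fun W hW => ?_⟩
  rw [hzero V hV0]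
  rcases le_or_gt 0 β with hβ | hβ
  · exact mul_nonneg (mul_nonneg hβ hc) lpCost_nonneg
  -- For negative `β`, nonnegativity of the cost of `V` forces that of `W` to vanish, so both sides
  -- of the claim are `0`.
  · have h1 := h.2 W hW
    have h2 : linfCost (restrictRows B (coreset k B)) W ≤ 0 := by
      have h3 := linfCost_nonneg (V := V) (restrictRows B (coreset k B))
      by_contra! h4
      nlinarith
    rw [hzero W h2, mul_zero]

theorem isApproxSolution_of_lt_finrank (hk : 1 ≤ k) (hp : 1 ≤ p)
    (hA : k < Module.finrank ℝ (rowspace A)) {e : Fin n → ℝ} (he : ∀ i, 1 / (100 * n) < e i)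
    {s : ℕ} {δ R η : ℝ} (hs : ⌊6300 * k * Real.log (n * onlineCond k A) ^ 2⌋₊ ≤ s)
    (hδ0 : 0 ≤ δ) (hδ : δ ≤ 1 / (30603 * (n * onlineCond k A) ^ 4)) (hR0 : 0 ≤ R)
    (hR : R ≤ 200000 * ((k : ℝ) ^ 2 * Real.log (n * onlineCond k A) ^ 3))
    (hη : η = √(3 * k * δ) * opNorm A)
    {V₀ : Submodule ℝ (EuclideanSpace ℝ (Fin d))} (hV₀ : Module.finrank ℝ V₀ = k)
    (hmin : ∀ U : Submodule ℝ (EuclideanSpace ℝ (Fin d)), Module.finrank ℝ U = k →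
      lpCost p A V₀ ≤ 2 * lpCost p A U)
    (he₀ : ∀ i, distTo V₀ (row A i) ^ p / (100 * lpCost p A V₀ ^ p) ≤ e i)
    (hnet : ∀ (f : Fin s → Fin n) (V : Submodule ℝ (EuclideanSpace ℝ (Fin d))),
      Module.finrank ℝ V = k → ∃ g : Fin k → EuclideanSpace ℝ (Fin d),
        (∀ w ∈ Submodule.span ℝ (row A '' Set.range f),
          distTo V w ≤ residual g w + √(3 * k * δ) * ‖w‖ ∧
            residual g w ≤ distTo V w + √(3 * k * δ) * ‖w‖) ∧
        ∃ i, e i * ∑ j, netWeight p A (Submodule.span ℝ (row A '' Set.range f)) η g j ≤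
          R * netWeight p A (Submodule.span ℝ (row A '' Set.range f)) η g i)
    {β : ℝ} {V : Submodule ℝ (EuclideanSpace ℝ (Fin d))}
    (h : IsApproxSolution k
      (linfCost (restrictRows (scaling p e * A) (coreset k (scaling p e * A)))) β V) :
    IsApproxSolution k (lpCost p A)
      (β * (10 ^ 11 * ((k : ℝ) ^ (1 / 2 + 2 / p) *
        Real.log (n * onlineCond k A) ^ (1 + 3 / p)))) V := by
  have hσ := sigmaOnline_pos_of_lt hA
  have hκ := one_le_onlineCond hA
  have hx := two_le_mul_onlineCond hk hA
  have hL := log_mul_onlineCond_ge hk hA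
  have hrank := finrank_rowspace_le (A := A)
  have hn1 : 1 ≤ n := by omega
  have hkn : (k : ℝ) ≤ n := by exact_mod_cast (by omega : k ≤ n)
  have hk1 : (1 : ℝ) ≤ k := by exact_mod_cast hk
  have hn0 : (0 : ℝ) < n := by linarith
  have hp0 : 0 < p := by linarith
  set L := Real.log (n * onlineCond k A) with hLdef
  have he0 : ∀ i, 0 < e i := fun i => lt_trans (by positivity) (he i)
  set B := scaling p e * A with hB
  set D : Fin n → ℝ := fun i => ((⌈e i ^ (-1 / p)⌉ : ℤ) : ℝ) with hDdef
  have hrow : ∀ i, row B i = D i • row A i := row_scaling_mul e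
  have hD : ∀ i, 1 ≤ D i := fun i => one_le_ceil_rpow (he0 i)
  have hD' : ∀ i, D i ≤ 101 * n := fun i => ceil_rpow_le hp hn1 (he i).le
  have hcard : ((coreset k B).card : ℝ) ≤ 6300 * k * L ^ 2 :=
    card_coreset_le_log hk hA hrow hD hD'
  have hcards : (coreset k B).card ≤ s := (Nat.le_floor hcard).trans hs
  set M := linfCost (restrictRows B (coreset k B)) V with hM
  have hM0 : 0 ≤ M := linfCost_nonneg _
  set Y := √(2 * (coreset k B).card) * M with hY
  have hY0 : 0 ≤ Y := by positivity
  have hYsq : Y ^ 2 = 2 * (coreset k B).card * M ^ 2 := by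
    rw [hY, mul_pow, Real.sq_sqrt (by positivity)]
  have hdist : ∀ (U : Submodule ℝ (EuclideanSpace ℝ (Fin d))) t,
      D t * distTo U (row A t) = distTo U (row B t) := fun U t => by
    rw [hrow, distTo_smul, abs_of_nonneg (by linarith [hD t])]
  have hYV : ∀ t, D t * distTo V (row A t) ≤ Y := fun t => by
    rw [hdist]
    refine abs_le_of_sq_le_sq' ?_ hY0 |>.2
    rw [hYsq]
    exact distTo_sq_le_linfCost hk h.1.le t
  -- No subspace of dimension `k` fits the rows better than `σ`, and every unscaled distance to `V`
  -- is at most `Y`. This keeps `Y` positive and large enough to absorb the additive net error.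
  have hσY : sigmaOnline k A ^ 2 ≤ n * Y ^ 2 := by
    refine (sigmaOnline_sq_le_sum_distTo hA h.1.le).trans ?_
    refine (Finset.sum_le_card_nsmul _ _ _ fun t _ => pow_le_pow_left₀ distTo_nonneg
      ((le_mul_of_one_le_left distTo_nonneg (hD t)).trans (hYV t)) 2).trans_eq ?_
    rw [nsmul_eq_mul, Finset.card_univ, Fintype.card_fin]
  have hYpos : 0 < Y := by
    refine hY0.lt_of_ne fun h0 => ?_
    rw [← h0] at hσY
    nlinarith
  have hMpos : 0 < M := by
    refine hM0.lt_of_ne fun h0 => ?_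
    rw [hY, ← h0, mul_zero] at hYpos
    exact lt_irrefl _ hYpos
  have hne : (coreset k B).Nonempty := by
    rw [Finset.nonempty_iff_ne_empty]
    intro h0
    rw [hY, h0] at hYpos
    simp at hYpos
  obtain ⟨f, hf⟩ := exists_range_eq_coe hne hcards
  obtain ⟨g, hg, i, hi⟩ := hnet f V h.1
  set W := Submodule.span ℝ (row A '' Set.range f) with hW
  have hWB : W = Submodule.span ℝ (row B '' (coreset k B : Set (Fin n))) := by
    rw [hW, hf, span_row_image_scaled hrow hD]
  have hYW : ∀ t, D t * distTo W (row A t) ≤ Y := fun t => by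
    rw [hdist]
    refine abs_le_of_sq_le_sq' ?_ hY0 |>.2
    rw [hYsq, hWB]
    exact distTo_span_coreset_sq_le hk h.1.le t
  have hη0 : 0 ≤ η := hη ▸ mul_nonneg (Real.sqrt_nonneg _) (norm_nonneg _)
  -- Since `D t ≤ 101 n`, `η² = 3kδ (κσ)²` and `σ² ≤ n Y²`, it suffices that `δ · 30603 (n κ)⁴ ≤ 1`.
  have hηY : ∀ t, D t * η ≤ Y := fun t => by
    refine (mul_le_mul_of_nonneg_right (hD' t) hη0).trans (abs_le_of_sq_le_sq' ?_ hY0 |>.2)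
    have h1 : η ^ 2 = 3 * k * δ * (onlineCond k A * sigmaOnline k A) ^ 2 := by
      rw [hη, mul_pow, Real.sq_sqrt (by positivity), onlineCond_mul_sigmaOnline hA]
    have h2 : δ * (30603 * (n * onlineCond k A) ^ 4) ≤ 1 :=
      (le_div_iff₀ (by positivity)).mp hδ
    have h3 : (n : ℝ) * (101 * n * η) ^ 2 ≤ sigmaOnline k A ^ 2 := by
      calc (n : ℝ) * (101 * n * η) ^ 2
          = (δ * 30603 * (n ^ 3 * k * onlineCond k A ^ 2)) * sigmaOnline k A ^ 2 := by
            rw [mul_pow, h1]; ring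
        _ ≤ (δ * 30603 * (n ^ 3 * n * onlineCond k A ^ 4)) * sigmaOnline k A ^ 2 := by
            have h4 : onlineCond k A ^ 2 ≤ onlineCond k A ^ 4 :=
              pow_le_pow_right₀ hκ (by norm_num)
            gcongr
        _ = (δ * (30603 * (n * onlineCond k A) ^ 4)) * sigmaOnline k A ^ 2 := by ring
        _ ≤ sigmaOnline k A ^ 2 := mul_le_of_le_one_left (sq_nonneg _) h2
    exact le_of_mul_le_mul_left (h3.trans hσY) hn0
  have hcost := lpCost_le_of_netWeight hp he0 (fun t => Int.le_ceil _) hη0 (Real.sqrt_nonneg _) hR0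
    hYV hYW hηY hg
    (fun t => hη ▸ mul_le_mul_of_nonneg_left (norm_row_le_opNorm t) (Real.sqrt_nonneg _)) hi
  have hV₀pos : 0 < lpCost p A V₀ := by
    refine lpCost_nonneg.lt_of_ne fun h0 => ?_
    have h1 := sigmaOnline_sq_le_lpCost hp hA hV₀.le
    rw [← h0] at h1
    nlinarith
  have hM₀ : linfCost (restrictRows B (coreset k B)) V₀ ≤ 101 * lpCost p A V₀ := by
    refine linfCost_restrictRows_le (by positivity) fun t _ => ?_
    rw [← hdist]
    exact ceil_rpow_mul_distTo_le hp he0 (he₀ t) hV₀pos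
  have hM₀0 : 0 ≤ linfCost (restrictRows B (coreset k B)) V₀ := linfCost_nonneg _
  have hβM := h.2 V₀ hV₀
  have hβ : 0 < β := by
    by_contra! h0
    have : β * linfCost (restrictRows B (coreset k B)) V₀ ≤ 0 :=
      mul_nonpos_of_nonpos_of_nonneg h0 hM₀0
    linarith
  have hL0 : 0 < L := by linarith
  -- Here `113² ≥ 2 · 6300`.
  have hYM : Y ≤ 113 * (√k * L) * M := by
    refine mul_le_mul_of_nonneg_right ?_ hM0
    rw [Real.sqrt_le_left (by positivity), mul_pow, mul_pow, Real.sq_sqrt (by positivity)]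
    have : 0 ≤ (k : ℝ) * L ^ 2 := by positivity
    linarith
  have hRp : R ^ (1 / p) ≤ 200000 * ((k : ℝ) ^ (2 / p) * L ^ (3 / p)) := by
    have hp1 : 1 / p ≤ 1 := (div_le_one hp0).mpr hp
    refine (Real.rpow_le_rpow hR0 hR (by positivity)).trans ?_
    rw [Real.mul_rpow (by norm_num) (by positivity), Real.mul_rpow (by positivity) (by positivity),
      ← Real.rpow_natCast (k : ℝ) 2, ← Real.rpow_natCast L 3, ← Real.rpow_mul (by positivity),
      ← Real.rpow_mul hL0.le]
    push_cast
    rw [mul_one_div, mul_one_div]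
    refine mul_le_mul_of_nonneg_right ?_ (by positivity)
    calc (200000 : ℝ) ^ (1 / p) ≤ 200000 ^ (1 : ℝ) :=
          Real.rpow_le_rpow_of_exponent_le (by norm_num) hp1
      _ = 200000 := Real.rpow_one _
  refine ⟨h.1, fun U hU => ?_⟩
  have hMU : M ≤ β * (202 * lpCost p A U) := by
    refine hβM.trans (mul_le_mul_of_nonneg_left ?_ hβ.le)
    linarith [hmin U hU]
  have hU0 : 0 ≤ lpCost p A U := lpCost_nonneg
  rw [Real.rpow_add (by linarith : (0 : ℝ) < k), Real.rpow_add hL0, Real.rpow_one,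
    ← Real.sqrt_eq_rpow]
  calc lpCost p A V ≤ R ^ (1 / p) * (5 * Y) := hcost
    _ ≤ (200000 * ((k : ℝ) ^ (2 / p) * L ^ (3 / p))) *
        (5 * (113 * (√k * L) * (β * (202 * lpCost p A U)))) := by
        refine mul_le_mul hRp (mul_le_mul_of_nonneg_left (hYM.trans ?_) (by norm_num))
          (by positivity) (by positivity)
        exact mul_le_mul_of_nonneg_left hMU (by positivity)
    -- The constant is `200000 · 5 · 113 · 202`, and `202 = 2 · 101` combines the near-optimality of
    -- `V₀` with the bound for its scaled distances.
    _ = 22826000000 * (β * (√k * (k : ℝ) ^ (2 / p) * (L * L ^ (3 / p))) * lpCost p A U) := by ring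
    _ ≤ 10 ^ 11 * (β * (√k * (k : ℝ) ^ (2 / p) * (L * L ^ (3 / p))) * lpCost p A U) :=
        mul_le_mul_of_nonneg_right (by norm_num) (by positivity)
    _ = _ := by ring

end Main

end SubspaceApprox

theorem mainTheorem2 :
    ∃ C : ℝ, 0 < C ∧
      ∀ (n d k : ℕ) (p : ℝ) (A : Matrix (Fin n) (Fin d) ℝ), 1 ≤ k → 1 ≤ p →
      ∀ (Ω : Type*) [MeasurableSpace Ω] (μ : Measure Ω) [IsProbabilityMeasure μ]
        (e : Fin n → Ω → ℝ),
        (∀ i, HasLaw (e i) (expMeasure 1) μ) → iIndepFun e μ →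
        9 / 10 ≤ μ {ω : Ω |
          ∀ (β : ℝ) (V : Submodule ℝ (EuclideanSpace ℝ (Fin d))),
            SubspaceApprox.IsApproxSolution k
              (SubspaceApprox.linfCost
                (SubspaceApprox.restrictRows
                  (SubspaceApprox.scaling p (fun i => e i ω) * A)
                  (SubspaceApprox.coreset k
                    (SubspaceApprox.scaling p (fun i => e i ω) * A)))) β V →
            SubspaceApprox.IsApproxSolution k (SubspaceApprox.lpCost p A)
              (β * (C * ((k : ℝ) ^ (1 / 2 + 2 / p) *
                Real.log (n * SubspaceApprox.onlineCond k A) ^ (1 + 3 / p)))) V} := by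
  classical
  refine ⟨10 ^ 11, by norm_num, ?_⟩
  intro n d k p A hk hp Ω _ μ _ e he hind
  have huniv : ∀ s : Set Ω, (∀ ω, ω ∈ s) → 9 / 10 ≤ μ s := fun s hs => by
    rw [Set.eq_univ_of_forall hs, measure_univ]
    exact ENNReal.div_le_of_le_mul (by norm_num)
  rcases Nat.eq_zero_or_pos n with hn | hn
  · subst hn
    refine huniv _ fun ω β V h => ?_
    have hz : ∀ U, SubspaceApprox.lpCost p A U = 0 := fun U =>
      SubspaceApprox.lpCost_eq_zero_of_rowspace_le hp (by
        rw [SubspaceApprox.rowspace, Set.range_eq_empty, Submodule.span_empty]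
        exact bot_le)
    refine ⟨h.1, fun W _ => ?_⟩
    rw [hz, hz, mul_zero]
  have hn0 : (0 : ℝ) < n := by exact_mod_cast hn
  have hs₁ : ∑ _i : Fin n, (1 / (100 * n) : ℝ) ≤ 1 / 100 := by
    rw [Finset.sum_const, Finset.card_univ, Fintype.card_fin, nsmul_eq_mul]
    exact (by field_simp : (n : ℝ) * (1 / (100 * n)) = 1 / 100).le
  rcases le_or_gt (Module.finrank ℝ (SubspaceApprox.rowspace A)) k with hA | hA
  -- When the rank is at most `k`, only positivity of the exponential variables matters, and it
  -- comes from `c₂ = 0`.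
  · refine SubspaceApprox.nine_tenths_le_measure he hind hn (c₁ := fun _ => 1 / (100 * n))
      (c₂ := fun _ => 0) (fun _ => by positivity) (fun _ => le_rfl) hs₁ (by simp)
      (∅ : Finset Unit) (fun _ _ => 0) (fun _ _ => le_rfl) (R := 0) le_rfl (by simp) ?_
    intro ω _ h2 _ β V h
    refine SubspaceApprox.isApproxSolution_of_finrank_le hk hp hA h2 ?_ h
    have := SubspaceApprox.log_mul_onlineCond_nonneg (k := k) (A := A)
    positivity
  by_cases hex : ∃ V : Submodule ℝ (EuclideanSpace ℝ (Fin d)), Module.finrank ℝ V = k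
  swap
  · exact huniv _ fun ω β V h => absurd ⟨V, h.1⟩ hex
  obtain ⟨V₁, hV₁⟩ := hex
  obtain ⟨V₀, hV₀, hmin⟩ := SubspaceApprox.exists_lpCost_le_two_mul hp hA hV₁
  have hx := SubspaceApprox.two_le_mul_onlineCond hk hA
  have hL := SubspaceApprox.log_mul_onlineCond_ge hk hA
  have hκ := SubspaceApprox.one_le_onlineCond hA
  have hrank := SubspaceApprox.finrank_rowspace_le (A := A)
  have hnx : (n : ℝ) ≤ n * SubspaceApprox.onlineCond k A := le_mul_of_one_le_right hn0.le hκ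
  have hkx : (k : ℝ) ≤ n * SubspaceApprox.onlineCond k A :=
    le_trans (by exact_mod_cast (by omega : k ≤ n)) hnx
  set x := n * SubspaceApprox.onlineCond k A with hxdef
  have hLx : Real.log x ≤ x := (Real.log_le_sub_one_of_pos (by linarith)).trans (by linarith)
  set s := ⌊6300 * k * Real.log x ^ 2⌋₊ with hs
  have hs' : (s : ℝ) ≤ 6300 * k * Real.log x ^ 2 := Nat.floor_le (by positivity)
  set N := SubspaceApprox.netFineness x with hN
  have hNpos : 0 < N := SubspaceApprox.netFineness_pos hx
  have hN0 : (0 : ℝ) < N := by exact_mod_cast hNpos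
  set δ := √(s : ℝ) / N with hδdef
  have hδ0 : 0 ≤ δ := by positivity
  have hδ : δ ≤ 1 / (30603 * x ^ 4) :=
    SubspaceApprox.sqrt_div_netFineness_le hx hkx (by linarith) hLx hs'
  have hδ1 : δ ≤ 1 := by
    refine hδ.trans ((div_le_one (by positivity)).mpr ?_)
    linarith [one_le_pow₀ (n := 4) (by linarith : 1 ≤ x)]
  have hsδ : (s : ℝ) ≤ (δ * N) ^ 2 := by
    rw [hδdef, div_mul_cancel₀ _ hN0.ne', Real.sq_sqrt (Nat.cast_nonneg s)]
  have hW : ∀ f : Fin s → Fin n, Module.finrank ℝ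
      (Submodule.span ℝ (SubspaceApprox.row A '' Set.range f)) ≤ s := fun f => by
    rw [← Set.range_comp]
    exact (finrank_range_le_card _).trans_eq (Fintype.card_fin s)
  -- The nets are fixed before the randomness, one for each `f : Fin s → Fin n`. Every possible
  -- nonempty selection of at most `s` rows is the range of such an `f`.
  choose G hGcard hG using fun f => SubspaceApprox.exists_net_distTo (hW f) hNpos hδ0 hδ1 hsδ k
  set R := Real.log (100 * SubspaceApprox.netCard n k s x) with hR
  have hcardpos : (1 : ℝ) ≤ SubspaceApprox.netCard n k s x := by
    have : 0 < SubspaceApprox.netCard n k s x := by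
      rw [SubspaceApprox.netCard]
      positivity
    exact_mod_cast this
  have hR0 : 0 ≤ R := Real.log_nonneg (by linarith)
  have hR1 : R ≤ 200000 * ((k : ℝ) ^ 2 * Real.log x ^ 3) :=
    SubspaceApprox.log_netCard_le hk hn hx hnx rfl hL hs'
  set η := √(3 * k * δ) * SubspaceApprox.opNorm A with hη
  have hη0 : 0 ≤ η := mul_nonneg (Real.sqrt_nonneg _) (norm_nonneg _)
  have hcost₀ : 0 ≤ SubspaceApprox.lpCost p A V₀ := SubspaceApprox.lpCost_nonneg
  -- The family `c₁` bounds all scaling factors by `101 n`, `c₂` bounds the scaled distances to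
  -- `V₀`, and the finite family of weights ranges over all pairs of a row choice and a net point.
  refine SubspaceApprox.nine_tenths_le_measure he hind hn (c₁ := fun _ => 1 / (100 * n))
    (c₂ := fun i => SubspaceApprox.distTo V₀ (SubspaceApprox.row A i) ^ p /
      (100 * SubspaceApprox.lpCost p A V₀ ^ p)) (fun _ => by positivity)
    (fun i => div_nonneg (Real.rpow_nonneg SubspaceApprox.distTo_nonneg _) (by positivity)) hs₁ ?_
    (Finset.univ.sigma G)
    (fun fg => SubspaceApprox.netWeight p A
      (Submodule.span ℝ (SubspaceApprox.row A '' Set.range fg.1)) η fg.2)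
    (fun fg i => Real.rpow_nonneg (SubspaceApprox.netWeight_base_nonneg hη0 _ _) _) hR0 ?_ ?_
  · rw [← Finset.sum_div, ← SubspaceApprox.lpCost_rpow hp]
    rcases (Real.rpow_nonneg hcost₀ p).eq_or_lt with h0 | h0
    · rw [← h0]
      norm_num
    · exact (by field_simp : SubspaceApprox.lpCost p A V₀ ^ p /
        (100 * SubspaceApprox.lpCost p A V₀ ^ p) = 1 / 100).le
  · have hcard : (Finset.univ.sigma G).card ≤ SubspaceApprox.netCard n k s x := by
      rw [Finset.card_sigma]
      refine (Finset.sum_le_card_nsmul _ _ _ fun f _ => hGcard f).trans_eq ?_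
      rw [smul_eq_mul, Finset.card_univ, Fintype.card_fun, Fintype.card_fin, Fintype.card_fin,
        SubspaceApprox.netCard]
    rw [hR, Real.exp_neg, Real.exp_log (by linarith), ← div_eq_mul_inv, div_le_iff₀ (by linarith)]
    have : ((Finset.univ.sigma G).card : ℝ) ≤ SubspaceApprox.netCard n k s x := by
      exact_mod_cast hcard
    linarith
  · intro ω h1 h2 h3 β V h
    refine SubspaceApprox.isApproxSolution_of_lt_finrank hk hp hA h1 le_rfl hδ0 hδ hR0 hR1 hη hV₀
      hmin (fun i => (h2 i).le) (fun f U hU => ?_) h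
    obtain ⟨g, hgG, hg⟩ := hG f U hU
    exact ⟨g, hg, h3 ⟨f, g⟩ (Finset.mem_sigma.mpr ⟨Finset.mem_univ _, hgG⟩)⟩
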